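/- Let $X_1,\dots,X_n$ be $1$-dependent random variables taking nonnegative integer values, i.e. for all $1\le r<t\le n$ with $t-r>1$ the $\sigma$-algebras $\sigma(X_1,\dots,X_r)$ and $\sigma(X_t,\dots,X_n)$ are independent. Suppose that, for some real $C_0\ge 1$, $X_i\le C_0$ almost surely for $1\le i\le n$. Let $S_n=X_1+\cdots+X_n$, let $$\nu_j(k)=\mathbb{E}\,X_k(X_k-1)\cdots(X_k-j+1)\qquad(j\ge 1,\ 1\le k\le n)$$ be the factorial moments, and let $\Gamma_1=\mathbb{E}S_n$. Let $s\ge1$ be an integer, $h\ge0$ and $\lambda_1,\dots,\lambda_s\ge0$ be real, and let $\mathrm{CP}(s,\lambda)$ be the distribution of $N_1+2N_2+\cdots+sN_s$, where $N_1,\dots,N_s$ are independent and $N_i$ is Poisson with parameter $\lambda_i$. Put $$a=e^{hC_0}(2+h)\sqrt{C_0},\qquad \psi=\exp\Bigl(\max\Bigl(4a^2\Gamma_1,\ \sum_{m=1}^s\lambda_m(e^{hm}+1)\Bigr)\Bigr),$$ $$K_1=\psi\sqrt{\pi+1}\,(e^h+1)^s(s+1+4a^2\Gamma_1),\qquad K_2=\psi\sqrt{\pi+1}\,(s+1+4a^2\Gamma_1)\frac{e^{hC_0}(e^h+1)^{s+1}}{(s+1)!},$$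 $$K_3=16\,\psi\,a^4\sqrt{\pi+1}\,(5+6a^2\Gamma_1),\qquad K_4=4\,\psi\,a^3\sqrt{\pi+1}\,(1.1+a^2\Gamma_1).$$ If $a^2\max_{1\le j\le n}\nu_1(j)\le 1/100$, then the series on the left below converges and $$\sum_{k=0}^\infty e^{hk}\bigl|P(S_n=k)-\mathrm{CP}(s,\lambda)\{k\}\bigr|\le K_1\sum_{m=1}^s\Bigl|\frac1{m!}\sum_{j=1}^n\nu_m(j)-\sum_{l=m}^s\binom{l}{m}\lambda_l\Bigr|+K_2\sum_{j=1}^n\nu_{s+1}(j)+K_3\sum_{j=1}^n\nu_1^2(j)+K_4\sum_{j=2}^n\bigl|\mathrm{Cov}(X_{j-1},X_j)\bigr|.$$ -/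

import Mathlib

open MeasureTheory ProbabilityTheory
open scoped NNReal

noncomputable section

namespace CPConv

variable {Ω : Type*} [MeasurableSpace Ω]

/-- The finite sequence `X 1, …, X n` is `m`-dependent: for all `1 ≤ s < t ≤ n` with `t - s > m`,
the sigma-algebras generated by `X 1, …, X s` and by `X t, …, X n` are independent. -/
def IsMDependent (m n : ℕ) (X : ℕ → Ω → ℕ) (P : Measure Ω) : Prop :=
  ∀ s t : ℕ, 1 ≤ s → s + m < t → t ≤ n →
    Indep (⨆ i ∈ Finset.Icc 1 s, MeasurableSpace.comap (X i) ⊤)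
      (⨆ i ∈ Finset.Icc t n, MeasurableSpace.comap (X i) ⊤) P

/-- The partial sum `S_n = X 1 + ⋯ + X n`. -/
def partialSum (X : ℕ → Ω → ℕ) (n : ℕ) (ω : Ω) : ℕ := ∑ i ∈ Finset.Icc 1 n, X i ω

/-- The factorial moment `ν_j(k) = E [X_k (X_k - 1) ⋯ (X_k - j + 1)]`. -/
def factMoment (P : Measure Ω) (X : ℕ → Ω → ℕ) (j k : ℕ) : ℝ :=
  ∫ ω, ((X k ω).descFactorial j : ℝ) ∂P

/-- `ν_1^{(n)} = max_{1 ≤ j ≤ n} ν_1(j)`. -/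
def maxNuOne (P : Measure Ω) (X : ℕ → Ω → ℕ) (n : ℕ) : ℝ :=
  ⨆ j : Finset.Icc 1 n, factMoment P X 1 j

/-- `Γ_1 = E S_n`. -/
def Gamma1 (P : Measure Ω) (X : ℕ → Ω → ℕ) (n : ℕ) : ℝ :=
  ∫ ω, (partialSum X n ω : ℝ) ∂P

/-- The covariance `Cov(X_i, X_j)`. -/
def covX (P : Measure Ω) (X : ℕ → Ω → ℕ) (i j : ℕ) : ℝ :=
  covariance (fun ω => (X i ω : ℝ)) (fun ω => (X j ω : ℝ)) P

/-- The compound Poisson distribution `CP(s, lam)`: the law of `N_1 + 2 N_2 + ⋯ + s N_s`,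
where the `N_i` are independent Poisson variables with parameters `lam i`. -/
def compoundPoisson (s : ℕ) (lam : ℕ → ℝ≥0) : Measure ℕ :=
  (Measure.pi fun i : Finset.Icc 1 s => poissonMeasure (lam i)).map
    fun N => ∑ i : Finset.Icc 1 s, (i : ℕ) * N i

/-- `a = e^{h C₀} (2 + h) √C₀`. -/
def constA (h C₀ : ℝ) : ℝ := Real.exp (h * C₀) * (2 + h) * √C₀

/-- `ψ = exp (max (4 a² Γ₁, ∑_{m=1}^s λ_m (e^{hm} + 1)))`. -/
def constPsi (h C₀ Γ₁ : ℝ) (s : ℕ) (lam : ℕ → ℝ≥0) : ℝ :=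
  Real.exp (max (4 * constA h C₀ ^ 2 * Γ₁)
    (∑ m ∈ Finset.Icc 1 s, (lam m : ℝ) * (Real.exp (h * m) + 1)))

def constK1 (h C₀ Γ₁ : ℝ) (s : ℕ) (lam : ℕ → ℝ≥0) : ℝ :=
  constPsi h C₀ Γ₁ s lam * √(Real.pi + 1) * (Real.exp h + 1) ^ s *
    (s + 1 + 4 * constA h C₀ ^ 2 * Γ₁)

def constK2 (h C₀ Γ₁ : ℝ) (s : ℕ) (lam : ℕ → ℝ≥0) : ℝ :=
  constPsi h C₀ Γ₁ s lam * √(Real.pi + 1) * (s + 1 + 4 * constA h C₀ ^ 2 * Γ₁) *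
    (Real.exp (h * C₀) * (Real.exp h + 1) ^ (s + 1) / ((s + 1).factorial : ℝ))

def constK3 (h C₀ Γ₁ : ℝ) (s : ℕ) (lam : ℕ → ℝ≥0) : ℝ :=
  16 * constPsi h C₀ Γ₁ s lam * constA h C₀ ^ 4 * √(Real.pi + 1) *
    (5 + 6 * constA h C₀ ^ 2 * Γ₁)

def constK4 (h C₀ Γ₁ : ℝ) (s : ℕ) (lam : ℕ → ℝ≥0) : ℝ :=
  4 * constPsi h C₀ Γ₁ s lam * constA h C₀ ^ 3 * √(Real.pi + 1) *
    (1.1 + constA h C₀ ^ 2 * Γ₁)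

end CPConv

end

/-!
Write `z = e ^ (h + i t)`. The exponentially weighted distance on the left-hand side is controlled
by the difference of the generating functions `E z ^ S_n` and `exp (∑ λ_m (z ^ m - 1))` on the circle
`|z| = e ^ h`, together with its derivative in `t`: by the Cauchy-Schwarz inequality with weights
`1 + k ^ 2` and Bessel's inequality (`sum_norm_le_of_norm_tsum_le`).

A function of `t` and its derivative are treated together, as an element of the Banach algebra of
dual numbers over `ℂ` (`Jet`), so that all estimates for `E z ^ S_n` take place in one normed ring
and no derivatives appear. Only the compound Poisson generating function is actually differentiated
(`integral_natCast_mul_pow_compoundPoisson`).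

Put `Y_i = z ^ X_i - 1`, `f_k = E ∏_{i ≤ k} (1 + Y_i)` and `m_{j,k} = E Y_j ⋯ Y_k`. Expanding the
factors `1 + Y_{k-1}, 1 + Y_{k-2}, …` of `E (∏_{i < k} (1 + Y_i)) Y_k` one at a time and using
`1`-dependence gives Heinrich's recursion `f_k = f_{k-1} + m_{1,k} + ∑_{0 ≤ j ≤ k-2} f_j m_{j+2,k}`
(`BddOneDep.ratioData`). The bound for `m_{j,k}` drops by a factor of order `a² ν₁(j) ≤ 1/100`
whenever two more variables are included, so the ratios `f_k / f_{k-1}` stay close to `1`, with main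
part `1 + E Y_k` (`RatioData.exists_ratio`). The leading correction `m_{k-1,k}` is at most a multiple
of `E X_{k-1} X_k ≤ |Cov(X_{k-1}, X_k)| + ν₁(k-1) ν₁(k)`. Hence `f_n` is the exponential of a jet
which is close to `∑ E Y_k` (`BddOneDep.exists_exponent`).

Newton's expansion of `z ^ x` in powers of `z - 1` (`newtonRem`) turns `∑ E Y_k` into factorial
moments, which are compared with `∑ λ_m (z ^ m - 1)` coefficient by coefficient
(`BddOneDep.norm_sum_sub_cpExponent_le`). The factor `ψ` comes from the mean value inequality for the
exponential (`norm_exp_jet_sub_le`). The sum `∑ 1 / (1 + k²)` over `k ≥ 0` is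
at most `1 + π² / 6`, and the margin between the square roots of this number and of `π + 1` absorbs a
factor `1.25` in the covariance term (`sqrt_mul_le`).
-/

namespace CPConv

/-! ### From generating functions to weighted `ℓ¹` distances -/

section Fourier

/-- Bessel's inequality for an absolutely convergent trigonometric series. -/
lemma sum_norm_sq_le_of_norm_tsum_le {u : ℕ → ℂ} (hu : Summable fun k => ‖u k‖) {M : ℝ}
    (hM : ∀ t : ℝ, ‖∑' k, u k * Complex.exp (Complex.I * k * t)‖ ≤ M) (s : Finset ℕ) :
    ∑ k ∈ s, ‖u k‖ ^ 2 ≤ M ^ 2 := by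
  have h2 : Fact (0 < 2 * Real.pi) := ⟨Real.two_pi_pos⟩
  have hM0 : 0 ≤ M := (norm_nonneg _).trans (hM 0)
  have hsum : Summable fun k : ℕ => u k • (fourier (k : ℤ) : C(AddCircle (2 * Real.pi), ℂ)) := by
    refine Summable.of_norm ?_
    simpa [norm_smul, fourier_norm] using hu
  set f : C(AddCircle (2 * Real.pi), ℂ) := ∑' k : ℕ, u k • fourier (k : ℤ) with hf
  have hfsum : HasSum (fun k : ℕ => u k • (fourier (k : ℤ) : C(AddCircle (2 * Real.pi), ℂ))) f :=
    hsum.hasSum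
  have hfM : ∀ x, ‖f x‖ ≤ M := by
    intro x
    induction x using QuotientAddGroup.induction_on with
    | H t =>
      have h1 := (ContinuousMap.evalCLM ℂ ((t : ℝ) : AddCircle (2 * Real.pi))).hasSum hfsum
      have h2 := hM t
      have h3 : ∀ k : ℕ, (ContinuousMap.evalCLM ℂ ((t : ℝ) : AddCircle (2 * Real.pi)))
          (u k • fourier (k : ℤ)) = u k * Complex.exp (Complex.I * k * t) := by
        intro k
        simp only [ContinuousMap.evalCLM_apply, ContinuousMap.smul_apply, smul_eq_mul,
          fourier_coe_apply]
        congr 2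
        have : (Real.pi : ℂ) ≠ 0 := by exact_mod_cast Real.pi_ne_zero
        push_cast
        field_simp
      simp_rw [h3] at h1
      rw [h1.tsum_eq] at h2
      exact h2
  set g : Lp ℂ 2 (@AddCircle.haarAddCircle (2 * Real.pi) h2) :=
    ContinuousMap.toLp (E := ℂ) 2 AddCircle.haarAddCircle ℂ f with hg
  have hgsum : HasSum (fun k : ℕ => u k • fourierLp (T := 2 * Real.pi) 2 (k : ℤ)) g := by
    have := (ContinuousMap.toLp (E := ℂ) 2 (@AddCircle.haarAddCircle (2 * Real.pi) h2) ℂ).hasSum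
      hfsum
    simpa using this
  have horth : Orthonormal ℂ fun k : ℕ => fourierLp (T := 2 * Real.pi) 2 (k : ℤ) :=
    (orthonormal_fourier (T := 2 * Real.pi)).comp _ Nat.cast_injective
  have hinner : ∀ k : ℕ, inner ℂ (fourierLp (T := 2 * Real.pi) 2 (k : ℤ)) g = u k := by
    intro k
    have h1 := (innerSL ℂ (fourierLp (T := 2 * Real.pi) 2 (k : ℤ))).hasSum hgsum
    refine h1.unique ?_
    have h3 : ∀ j : ℕ, (innerSL ℂ (fourierLp (T := 2 * Real.pi) 2 (k : ℤ)))
        (u j • fourierLp (T := 2 * Real.pi) 2 (j : ℤ)) = if j = k then u k else 0 := by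
      intro j
      rw [innerSL_apply_apply, inner_smul_right, orthonormal_iff_ite.1 horth k j]
      by_cases hjk : j = k
      · simp [hjk]
      · simp [hjk, Ne.symm hjk]
    simp_rw [h3]
    exact hasSum_ite_eq k (u k)
  have hB := horth.sum_inner_products_le g (s := s)
  simp_rw [hinner] at hB
  refine hB.trans ?_
  have : ‖g‖ ≤ M := by
    have h4 := Lp.norm_le_of_ae_bound (f := g) hM0 (by
      filter_upwards [ContinuousMap.coeFn_toLp (p := 2) (𝕜 := ℂ)
        (@AddCircle.haarAddCircle (2 * Real.pi) h2) f] with x hx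
      rw [hg, hx]
      exact hfM x)
    simpa [measureUnivNNReal] using h4
  gcongr

/-- A bound on a trigonometric series with absolutely summable coefficients and on its derivative
bounds the sum of the coefficients, by the Cauchy-Schwarz inequality with weights `1 + k ^ 2`. -/
lemma sum_norm_le_of_norm_tsum_le {u : ℕ → ℂ} (hu : Summable fun k => ‖u k‖)
    (hu' : Summable fun k : ℕ => ‖(k : ℂ) * u k‖) {M₀ M₁ : ℝ}
    (h₀ : ∀ t : ℝ, ‖∑' k, u k * Complex.exp (Complex.I * k * t)‖ ≤ M₀)
    (h₁ : ∀ t : ℝ, ‖∑' k : ℕ, (k : ℂ) * u k * Complex.exp (Complex.I * k * t)‖ ≤ M₁) :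
    ∑' k, ‖u k‖ ≤ √(1 + Real.pi ^ 2 / 6) * (M₀ + M₁) := by
  have hM0 : 0 ≤ M₀ := (norm_nonneg _).trans (h₀ 0)
  have hM1 : 0 ≤ M₁ := (norm_nonneg _).trans (h₁ 0)
  refine hu.tsum_le_of_sum_le fun s => ?_
  have hA := sum_norm_sq_le_of_norm_tsum_le hu h₀ s
  have hB := sum_norm_sq_le_of_norm_tsum_le hu' h₁ s
  have hw : ∑ k ∈ s, (1 + (k : ℝ) ^ 2)⁻¹ ≤ 1 + Real.pi ^ 2 / 6 := by
    calc ∑ k ∈ s, (1 + (k : ℝ) ^ 2)⁻¹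
        ≤ ∑ k ∈ s, ((if k = 0 then 1 else 0) + 1 / (k : ℝ) ^ 2) := by
          refine Finset.sum_le_sum fun k _ => ?_
          rcases eq_or_ne k 0 with rfl | hk
          · simp
          · have : (0 : ℝ) < k := by positivity
            rw [if_neg hk, zero_add, one_div]
            gcongr
            linarith
      _ ≤ 1 + Real.pi ^ 2 / 6 := by
          have h6 : HasSum (fun k : ℕ => (if k = 0 then (1 : ℝ) else 0) + 1 / (k : ℝ) ^ 2)
              (1 + Real.pi ^ 2 / 6) := (hasSum_ite_eq 0 1).add hasSum_zeta_two
          exact sum_le_hasSum s (fun k _ => by positivity) h6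
  have hCS := Finset.sum_mul_sq_le_sq_mul_sq s (fun k => √((1 + (k : ℝ) ^ 2)⁻¹))
    (fun k => √(1 + (k : ℝ) ^ 2) * ‖u k‖)
  have e1 : ∀ k : ℕ, √((1 + (k : ℝ) ^ 2)⁻¹) * (√(1 + (k : ℝ) ^ 2) * ‖u k‖) = ‖u k‖ := by
    intro k
    have : 0 < √(1 + (k : ℝ) ^ 2) := Real.sqrt_pos.2 (by positivity)
    rw [Real.sqrt_inv, inv_mul_cancel_left₀ this.ne']
  have e2 : ∀ k : ℕ, √((1 + (k : ℝ) ^ 2)⁻¹) ^ 2 = (1 + (k : ℝ) ^ 2)⁻¹ :=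
    fun k => Real.sq_sqrt (by positivity)
  have e3 : ∀ k : ℕ, (√(1 + (k : ℝ) ^ 2) * ‖u k‖) ^ 2 = ‖u k‖ ^ 2 + ‖(k : ℂ) * u k‖ ^ 2 := by
    intro k
    rw [mul_pow, Real.sq_sqrt (by positivity), norm_mul, Complex.norm_natCast]
    ring
  simp_rw [e1, e2, e3, Finset.sum_add_distrib] at hCS
  have hfin : (∑ k ∈ s, ‖u k‖) ^ 2 ≤ (√(1 + Real.pi ^ 2 / 6) * (M₀ + M₁)) ^ 2 := by
    rw [mul_pow, Real.sq_sqrt (by positivity)]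
    refine hCS.trans ?_
    have : 0 ≤ ∑ k ∈ s, ‖u k‖ ^ 2 := by positivity
    gcongr
    nlinarith [mul_nonneg hM0 hM1]
  exact abs_le_of_sq_le_sq' hfin (by positivity) |>.2

end Fourier

/-! ### Ratios of consecutive terms of a recursion in a Banach algebra -/

section Ratio

variable {A : Type*} [NormedCommRing A]

/-- The data of Heinrich's recursion. Think of `f k = E ∏_{i ≤ k} (1 + Y i)`,
`m j k = E ∏_{j ≤ i ≤ k} Y i`, `G j k = E (∏_{i ≤ j} (1 + Y i)) ∏_{j < i ≤ k} Y i` for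
`1`-dependent `Y i`. `Q` bounds `m`, with two separate bounds for `Q (k - 1) k`: the bound by `μ k`
keeps the ratios near `1`, the bound by `p k` is the smaller one that enters the error. -/
structure RatioData (f : ℕ → A) (m G : ℕ → ℕ → A) (Q : ℕ → ℕ → ℝ) (μ p : ℕ → ℝ) : Prop where
  f_zero : f 0 = 1
  G_zero : ∀ k, 1 ≤ k → G 0 k = m 1 k
  G_succ : ∀ j k, j + 2 ≤ k → G (j + 1) k = G j k + f j * m (j + 2) k
  f_succ : ∀ k, f (k + 1) = G k (k + 1) + f k
  norm_m : ∀ j k, j ≤ k → ‖m j k‖ ≤ Q j k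
  μ_nonneg : ∀ k, 0 ≤ μ k
  μ_le : ∀ k, μ k ≤ 1 / 100
  Q_self : ∀ k, Q k k ≤ 3 / 4 * μ k
  Q_succ : ∀ k, Q k (k + 1) ≤ 9 / 4 * μ (k + 1)
  Q_succ' : ∀ k, Q k (k + 1) ≤ p (k + 1)
  Q_step : ∀ j k, j + 2 ≤ k → Q j k ≤ 9 / 4 * μ j * Q (j + 2) k

variable {f : ℕ → A} {m G : ℕ → ℕ → A} {Q : ℕ → ℕ → ℝ} {μ p : ℕ → ℝ}

lemma RatioData.Q_nonneg (H : RatioData f m G Q μ p) {j k : ℕ} (hjk : j ≤ k) : 0 ≤ Q j k :=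
  (norm_nonneg _).trans (H.norm_m j k hjk)

variable [NormOneClass A] [CompleteSpace A]

/-- An element close to `1` has an inverse of controlled norm. -/
lemma exists_inv_of_norm_sub_one_le {r : A} {q : ℝ} (hr : ‖r - 1‖ ≤ q) (hq : q < 1) :
    ∃ v : A, v * r = 1 ∧ ‖v‖ ≤ (1 - q)⁻¹ ∧ ‖v - 1‖ ≤ (1 - q)⁻¹ * q := by
  have hu : IsUnit r := by
    have := isUnit_one_sub_of_norm_lt_one (x := 1 - r) (by
      rw [norm_sub_rev]; exact hr.trans_lt hq)
    simpa using this
  obtain ⟨v, hv⟩ := hu.exists_left_inv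
  have h1 : v - 1 = - (v * (r - 1)) := by rw [mul_sub, hv]; ring
  have h2 : ‖v - 1‖ ≤ ‖v‖ * q := by
    rw [h1, norm_neg]
    exact (norm_mul_le _ _).trans (by gcongr)
  have h3 : ‖v‖ ≤ ‖v - 1‖ + 1 := by simpa using norm_add_le (v - 1) 1
  have hv' : ‖v‖ ≤ (1 - q)⁻¹ := by
    rw [← one_div, le_div_iff₀ (by linarith)]
    linarith
  refine ⟨v, hv, hv', h2.trans ?_⟩
  have : 0 ≤ q := (norm_nonneg _).trans hr
  gcongr

/-- Passing from `G j k / f j` to `G (j + 1) k / f (j + 1)`. -/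
lemma RatioData.step (H : RatioData f m G Q μ p) {j k : ℕ} (hjk : j + 2 ≤ k)
    {r u : A} (hr : f (j + 1) = r * f j) (hr1 : ‖r - 1‖ ≤ 3.3 * μ (j + 1))
    (hu : G j k = u * f j) :
    ∃ v : A, ‖v‖ ≤ 1.0342 ∧ ‖v - 1‖ ≤ 1.0342 * (3.3 * μ (j + 1)) ∧
      G (j + 1) k = v * (u + m (j + 2) k) * f (j + 1) := by
  have hμ := H.μ_le (j + 1)
  have hμ0 := H.μ_nonneg (j + 1)
  have hρ : (1 - 3.3 * μ (j + 1))⁻¹ ≤ 1.0342 := by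
    rw [← one_div, div_le_iff₀ (by linarith)]
    linarith
  obtain ⟨v, hv, hv1, hv2⟩ := exists_inv_of_norm_sub_one_le hr1 (by linarith)
  refine ⟨v, hv1.trans hρ, hv2.trans (by gcongr), ?_⟩
  rw [H.G_succ j k hjk, hr, hu]
  linear_combination (-(u + m (j + 2) k) * f j) * hv

/-- The constants `1.06` and `1.097` satisfy `1.06 ≥ ρ (1 + 0.0225 * 1.097)` and
`1.097 ≥ ρ * 1.06`, where `ρ = 1.0342` bounds the inverses of the previous ratios; this makes the
two-step bound reproduce itself. -/
lemma RatioData.exists_quotient (H : RatioData f m G Q μ p) {k : ℕ} (hk : 1 ≤ k)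
    (hprev : ∀ i, i + 1 < k → ∃ r : A, f (i + 1) = r * f i ∧ ‖r - 1‖ ≤ 3.3 * μ (i + 1)) :
    ∀ j, j + 1 ≤ k → ∃ u : A, G j k = u * f j ∧
      ‖u‖ ≤ 1.06 * Q (j + 1) k + 1.097 * Q j k := by
  intro j
  induction j with
  | zero =>
    intro _
    refine ⟨m 1 k, by rw [H.G_zero k hk, H.f_zero, mul_one], ?_⟩
    have h1 := H.norm_m 1 k hk
    have h2 := H.Q_nonneg (Nat.zero_le k)
    have h3 := H.Q_nonneg hk
    simp only [zero_add]
    linarith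
  | succ j ih =>
    intro hj
    obtain ⟨u, hu, hu'⟩ := ih (by omega)
    obtain ⟨r, hr, hr'⟩ := hprev j (by omega)
    obtain ⟨v, hv, -, hv'⟩ := H.step (by omega) hr hr' hu
    refine ⟨_, hv', ?_⟩
    have h1 := H.norm_m (j + 2) k hj
    have h2 := H.Q_step j k hj
    have h3 := H.Q_nonneg (j := j + 2) hj
    have h4 := H.Q_nonneg (j := j + 1) (k := k) (by omega)
    have hμ := H.μ_le j
    have h5 : Q j k ≤ 0.0225 * Q (j + 2) k := h2.trans (by gcongr; linarith)
    calc ‖v * (u + m (j + 2) k)‖ ≤ ‖v‖ * (‖u‖ + ‖m (j + 2) k‖) :=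
          (norm_mul_le _ _).trans (by gcongr; exact norm_add_le _ _)
      _ ≤ 1.0342 * ((1.06 * Q (j + 1) k + 1.097 * Q j k) + Q (j + 2) k) := by gcongr
      _ ≤ _ := by
        rw [show j + 1 + 1 = j + 2 from rfl]
        linarith

/-- The ratios of Heinrich's recursion are close to `1`, and `m k k` is their main part. -/
lemma RatioData.exists_ratio (H : RatioData f m G Q μ p) (k : ℕ) :
    ∃ r : A, f (k + 1) = r * f k ∧ ‖r - 1‖ ≤ 3.3 * μ (k + 1) ∧
      ‖r - 1 - m (k + 1) (k + 1)‖ ≤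
        2.6 * μ k * μ (k + 1) + 1.097 * p (k + 1) + 1.92 * μ (k - 1) * μ (k + 1) := by
  induction k using Nat.strong_induction_on with
  | _ k ih =>
  have hprev : ∀ i, i + 1 < k + 1 →
      ∃ r : A, f (i + 1) = r * f i ∧ ‖r - 1‖ ≤ 3.3 * μ (i + 1) := fun i hi => by
    obtain ⟨r, h1, h2, -⟩ := ih i (by omega)
    exact ⟨r, h1, h2⟩
  have hμ := H.μ_nonneg
  have hQ1 := H.Q_self (k + 1)
  have hQ2 := H.Q_succ k
  have hQ3 := H.Q_succ' k
  have hp : 0 ≤ p (k + 1) := (H.Q_nonneg (by omega)).trans hQ3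
  have key : ∀ u : A, G k (k + 1) = u * f k → f (k + 1) = (1 + u) * f k := by
    intro u hu
    rw [H.f_succ, hu]; ring
  have bound : ∀ u : A, ‖u‖ ≤ 1.06 * Q (k + 1) (k + 1) + 1.097 * Q k (k + 1) →
      ‖1 + u - 1‖ ≤ 3.3 * μ (k + 1) := by
    intro u hu
    rw [add_sub_cancel_left]
    linarith [hμ (k + 1)]
  rcases k with _ | k
  · refine ⟨1 + m 1 1, key _ (by rw [H.G_zero _ le_rfl, H.f_zero, mul_one]), bound _ ?_, ?_⟩
    · have := H.norm_m 1 1 le_rfl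
      have h2 := H.Q_nonneg (Nat.zero_le 1)
      have h3 := H.Q_nonneg (le_refl 1)
      simp only [zero_add]
      linarith
    · rw [show (1 : A) + m 1 1 - 1 - m (0 + 1) (0 + 1) = 0 by simp, norm_zero]
      have h1 := mul_nonneg (hμ 0) (hμ (0 + 1))
      have h2 := mul_nonneg (hμ (0 - 1)) (hμ (0 + 1))
      linarith
  · obtain ⟨u, hu, hu'⟩ := H.exists_quotient (k := k + 2) (by omega) hprev k (by omega)
    obtain ⟨r, hr, hr'⟩ := hprev k (by omega)
    obtain ⟨v, hv, hv1, hv'⟩ := H.step (j := k) (k := k + 2) le_rfl hr hr' hu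
    have h1 := H.norm_m (k + 2) (k + 2) le_rfl
    have h2 := H.Q_step k (k + 2) le_rfl
    have h3 := H.Q_nonneg (le_refl (k + 2))
    have h4 := H.Q_nonneg (j := k + 1) (k := k + 2) (by omega)
    have h0 := H.Q_nonneg (j := k) (k := k + 2) (by omega)
    have hμk := H.μ_le k
    simp only [Nat.add_assoc, Nat.reduceAdd, Nat.add_sub_cancel] at *
    have h5 : Q k (k + 2) ≤ 0.0225 * Q (k + 2) (k + 2) := h2.trans (by gcongr; linarith)
    have h6 : Q k (k + 2) ≤ 9 / 4 * μ k * (3 / 4 * μ (k + 2)) := by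
      refine h2.trans ?_
      have := hμ k
      gcongr
    refine ⟨_, key _ hv', bound _ ?_, ?_⟩
    · calc ‖v * (u + m (k + 2) (k + 2))‖ ≤ ‖v‖ * (‖u‖ + ‖m (k + 2) (k + 2)‖) :=
          (norm_mul_le _ _).trans (by gcongr; exact norm_add_le _ _)
        _ ≤ 1.0342 * ((1.06 * Q (k + 1) (k + 2) + 1.097 * Q k (k + 2)) + Q (k + 2) (k + 2)) := by
          gcongr
        _ ≤ _ := by linarith
    · have e : (1 : A) + v * (u + m (k + 2) (k + 2)) - 1 - m (k + 2) (k + 2) =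
          (v - 1) * m (k + 2) (k + 2) + v * u := by ring
      rw [e]
      have hk1 := hμ (k + 1)
      have hk2 := hμ (k + 2)
      calc ‖(v - 1) * m (k + 2) (k + 2) + v * u‖
          ≤ ‖v - 1‖ * ‖m (k + 2) (k + 2)‖ + ‖v‖ * ‖u‖ :=
            (norm_add_le _ _).trans (add_le_add (norm_mul_le _ _) (norm_mul_le _ _))
        _ ≤ 1.0342 * (3.3 * μ (k + 1)) * (3 / 4 * μ (k + 2)) +
            1.0342 * (1.06 * p (k + 2) + 1.097 * (9 / 4 * μ k * (3 / 4 * μ (k + 2)))) := by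
          have : ‖m (k + 2) (k + 2)‖ ≤ 3 / 4 * μ (k + 2) := h1.trans hQ1
          have : ‖u‖ ≤ 1.06 * p (k + 2) + 1.097 * (9 / 4 * μ k * (3 / 4 * μ (k + 2))) :=
            hu'.trans (by gcongr)
          gcongr
        _ ≤ _ := by
          have a1 := mul_nonneg hk1 hk2
          have a2 := mul_nonneg (hμ k) hk2
          nlinarith

end Ratio

/-! ### Heinrich's recursion for `1`-dependent variables -/

section Expectation

variable {Ω : Type*}

/-- The σ-algebra generated by `X i`, `i ≤ r`. -/
abbrev past (X : ℕ → Ω → ℕ) (r : ℕ) : MeasurableSpace Ω :=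
  ⨆ i ∈ Set.Iic r, MeasurableSpace.comap (X i) ⊤

/-- The σ-algebra generated by `X i`, `i ≥ t`. -/
abbrev future (X : ℕ → Ω → ℕ) (t : ℕ) : MeasurableSpace Ω :=
  ⨆ i ∈ Set.Ici t, MeasurableSpace.comap (X i) ⊤

lemma measurable_past (X : ℕ → Ω → ℕ) {i r : ℕ} (hi : i ≤ r) : Measurable[past X r] (X i) :=
  measurable_iff_comap_le.2
    (le_iSup₂_of_le (f := fun i (_ : i ∈ Set.Iic r) => MeasurableSpace.comap (X i) ⊤) i hi le_rfl)

lemma measurable_future (X : ℕ → Ω → ℕ) {i t : ℕ} (hi : t ≤ i) : Measurable[future X t] (X i) :=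
  measurable_iff_comap_le.2
    (le_iSup₂_of_le (f := fun i (_ : i ∈ Set.Ici t) => MeasurableSpace.comap (X i) ⊤) i hi le_rfl)

variable {mΩ : MeasurableSpace Ω} {P : Measure Ω}

/-- An infinite sequence of `1`-dependent variables which starts at `X 0 = 0` and is bounded by
`C₀` everywhere. -/
structure BddOneDep (P : Measure Ω) (X : ℕ → Ω → ℕ) (C₀ : ℝ) : Prop where
  meas : ∀ i, Measurable (X i)
  zero : ∀ ω, X 0 ω = 0
  bdd : ∀ i ω, (X i ω : ℝ) ≤ C₀
  indep : ∀ r t, r + 1 < t → Indep (past X r) (future X t) P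

/-- The expectation of a product in a Banach algebra factors over independent σ-algebras. -/
lemma integral_mul_of_indep {A : Type*} [NormedRing A] [NormedAlgebra ℝ A] [CompleteSpace A]
    {m₁ m₂ : MeasurableSpace Ω} (h : Indep m₁ m₂ P)
    {U V : Ω → A} (hU : StronglyMeasurable[m₁] U) (hV : StronglyMeasurable[m₂] V)
    (hUi : Integrable U P) (hVi : Integrable V P) :
    ∫ ω, U ω * V ω ∂P = (∫ ω, U ω ∂P) * ∫ ω, V ω ∂P := by
  borelize A
  have hind : IndepFun U V P := by
    rw [IndepFun_iff_Indep]
    exact indep_of_indep_of_le_left (indep_of_indep_of_le_right h hV.measurable.comap_le)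
      hU.measurable.comap_le
  exact hind.integral_bilin hUi hVi (ContinuousLinearMap.mul ℝ A)

variable {A : Type*} [NormedCommRing A]

/-- The product of `z ^ X i - 1` over `j ≤ i ≤ k`. -/
def centeredProd (X : ℕ → Ω → ℕ) (z : A) (j k : ℕ) (ω : Ω) : A :=
  ∏ i ∈ Finset.Icc j k, (z ^ X i ω - 1)

/-- The product of `z ^ X i` over `i ≤ k`. -/
def powProd (X : ℕ → Ω → ℕ) (z : A) (k : ℕ) (ω : Ω) : A :=
  ∏ i ∈ Finset.range (k + 1), z ^ X i ω

lemma centeredProd_eq_mul (X : ℕ → Ω → ℕ) (z : A) {j k : ℕ} (hjk : j ≤ k) (ω : Ω) :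
    centeredProd X z j k ω = (z ^ X j ω - 1) * centeredProd X z (j + 1) k ω := by
  rw [centeredProd, ← Finset.mul_prod_Ioc_eq_prod_Icc hjk, centeredProd,
    ← Finset.Icc_add_one_left_eq_Ioc]

lemma centeredProd_self (X : ℕ → Ω → ℕ) (z : A) (k : ℕ) (ω : Ω) :
    centeredProd X z k k ω = z ^ X k ω - 1 := by
  simp [centeredProd]

lemma powProd_succ (X : ℕ → Ω → ℕ) (z : A) (k : ℕ) (ω : Ω) :
    powProd X z (k + 1) ω = powProd X z k ω * z ^ X (k + 1) ω :=
  Finset.prod_range_succ _ _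

lemma stronglyMeasurable_centeredProd (X : ℕ → Ω → ℕ) (z : A) (j k : ℕ) :
    StronglyMeasurable[future X j] (centeredProd X z j k) := by
  refine Finset.stronglyMeasurable_fun_prod _ fun i hi => ?_
  exact (StronglyMeasurable.of_discrete (f := fun x : ℕ => z ^ x - 1)).comp_measurable
    (measurable_future X (Finset.mem_Icc.1 hi).1)

lemma stronglyMeasurable_powProd (X : ℕ → Ω → ℕ) (z : A) (k : ℕ) :
    StronglyMeasurable[past X k] (powProd X z k) := by
  refine Finset.stronglyMeasurable_fun_prod _ fun i hi => ?_
  exact (StronglyMeasurable.of_discrete (f := fun x : ℕ => z ^ x)).comp_measurable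
    (measurable_past X (Finset.mem_range_succ_iff.1 hi))

section

variable {X : ℕ → Ω → ℕ} {C₀ : ℝ}

variable [IsProbabilityMeasure P]

/-- A product of functions of finitely many of the bounded variables `X i` is integrable. -/
lemma BddOneDep.integrable_prod [NormOneClass A] (h : BddOneDep P X C₀) (s : Finset ℕ)
    (g : ℕ → A) : Integrable (fun ω => ∏ i ∈ s, g (X i ω)) P := by
  obtain ⟨C, hC⟩ : ∃ C, ∀ x : ℕ, (x : ℝ) ≤ C₀ → ‖g x‖ ≤ C := by
    refine ⟨∑ x ∈ Finset.range (⌊C₀⌋₊ + 1), ‖g x‖, fun x hx => ?_⟩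
    exact Finset.single_le_sum (f := fun x => ‖g x‖) (fun _ _ => norm_nonneg _)
      (Finset.mem_range_succ_iff.2 (Nat.le_floor hx))
  refine Integrable.of_bound (C := C ^ s.card) ?_ (Filter.Eventually.of_forall fun ω => ?_)
  · refine (Finset.stronglyMeasurable_fun_prod _ fun i _ => ?_).aestronglyMeasurable
    exact StronglyMeasurable.of_discrete.comp_measurable (h.meas i)
  · refine (Finset.norm_prod_le _ _).trans ?_
    rw [← Finset.prod_const]
    exact Finset.prod_le_prod (fun _ _ => norm_nonneg _) fun i _ => hC _ (h.bdd i ω)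

lemma BddOneDep.integrable_comp [NormOneClass A] (h : BddOneDep P X C₀) (i : ℕ)
    (g : ℕ → A) : Integrable (fun ω => g (X i ω)) P := by
  simpa using h.integrable_prod {i} g

lemma BddOneDep.integrable_natCast_mul (h : BddOneDep P X C₀) (i j : ℕ) :
    Integrable (fun ω => (X i ω : ℝ) * X j ω) P :=
  (h.integrable_comp i fun x => (x : ℝ)).mul_bdd (c := C₀)
    (StronglyMeasurable.of_discrete.comp_measurable (h.meas j)).aestronglyMeasurable
    (Filter.Eventually.of_forall fun ω => by simpa using h.bdd j ω)

variable [NormOneClass A] [NormedAlgebra ℝ A] [CompleteSpace A]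

/-- The expectations of products of `z ^ X i` satisfy Heinrich's recursion, whenever
`z ^ x - 1` is at most linear in `x ≤ C₀`. -/
theorem BddOneDep.ratioData (h : BddOneDep P X C₀) {z : A} {c K : ℝ} (hc : 0 ≤ c)
    (hz : ∀ x : ℕ, (x : ℝ) ≤ C₀ → ‖z ^ x - 1‖ ≤ c * x)
    (hcK : c ≤ 3 / 4 * K) (hcK' : c ^ 2 * C₀ ≤ 9 / 4 * K)
    (hK : ∀ k, K * ∫ ω, (X k ω : ℝ) ∂P ≤ 1 / 100) :
    RatioData (fun k => ∫ ω, powProd X z k ω ∂P) (fun j k => ∫ ω, centeredProd X z j k ω ∂P)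
      (fun j k => ∫ ω, powProd X z j ω * centeredProd X z (j + 1) k ω ∂P)
      (fun j k => ∫ ω, ‖centeredProd X z j k ω‖ ∂P)
      (fun k => K * ∫ ω, (X k ω : ℝ) ∂P)
      (fun k => c ^ 2 * ∫ ω, (X (k - 1) ω : ℝ) * X k ω ∂P) := by
  have hK0 : 0 ≤ K := by linarith
  have hint : ∀ k, Integrable (fun ω => (X k ω : ℝ)) P :=
    fun k => h.integrable_comp k fun x => (x : ℝ)
  have hν : ∀ k, 0 ≤ ∫ ω, (X k ω : ℝ) ∂P := fun k => integral_nonneg fun ω => Nat.cast_nonneg _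
  have hcent : ∀ j k, Integrable (centeredProd X z j k) P :=
    fun j k => h.integrable_prod (Finset.Icc j k) fun x => z ^ x - 1
  have hpow : ∀ k, Integrable (powProd X z k) P :=
    fun k => h.integrable_prod (Finset.range (k + 1)) fun x => z ^ x
  have hpc : ∀ j k, Integrable (fun ω => powProd X z j ω * centeredProd X z (j + 1) k ω) P := by
    intro j k
    obtain ⟨C, hC⟩ : ∃ C, ∀ ω, ‖powProd X z j ω‖ ≤ C := by
      refine ⟨∏ i ∈ Finset.range (j + 1), (1 + c * C₀), fun ω => ?_⟩
      refine (Finset.norm_prod_le _ _).trans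
        (Finset.prod_le_prod (fun _ _ => norm_nonneg _) fun i _ => ?_)
      calc ‖z ^ X i ω‖ ≤ ‖(1 : A)‖ + ‖z ^ X i ω - 1‖ := by
            simpa using norm_add_le (1 : A) (z ^ X i ω - 1)
        _ ≤ 1 + c * C₀ := by
            rw [norm_one]
            have := hz _ (h.bdd i ω)
            have := mul_le_mul_of_nonneg_left (h.bdd i ω) hc
            linarith
    exact (hcent (j + 1) k).bdd_mul (hpow j).aestronglyMeasurable
      (Filter.Eventually.of_forall hC)
  have hQ2 : ∀ k, ∫ ω, ‖centeredProd X z k (k + 1) ω‖ ∂P ≤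
      c ^ 2 * ∫ ω, (X k ω : ℝ) * X (k + 1) ω ∂P := by
    intro k
    rw [← integral_const_mul]
    refine integral_mono (hcent _ _).norm ((h.integrable_natCast_mul _ _).const_mul _) fun ω => ?_
    simp only
    rw [centeredProd_eq_mul X z (Nat.le_succ k), centeredProd_self]
    refine (norm_mul_le _ _).trans ?_
    calc _ ≤ (c * X k ω) * (c * X (k + 1) ω) := by
          gcongr
          · exact hz _ (h.bdd _ ω)
          · exact hz _ (h.bdd _ ω)
      _ = _ := by ring
  refine
    { f_zero := ?_, G_zero := ?_, G_succ := ?_, f_succ := ?_, norm_m := ?_, μ_nonneg := ?_,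
      μ_le := hK, Q_self := ?_, Q_succ := ?_, Q_succ' := ?_, Q_step := ?_ }
  · simp [powProd, h.zero]
  · intro k _
    simp [powProd, h.zero]
  · intro j k hjk
    have hind := integral_mul_of_indep (h.indep j (j + 2) (by omega))
      (stronglyMeasurable_powProd X z j) (stronglyMeasurable_centeredProd X z (j + 2) k)
      (hpow j) (hcent (j + 2) k)
    rw [← hind, ← integral_add (hpc j k)]
    · refine integral_congr_ae (Filter.Eventually.of_forall fun ω => ?_)
      beta_reduce
      rw [powProd_succ, centeredProd_eq_mul X z (show j + 1 ≤ k by omega)]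
      ring
    · have h1 := (hpc (j + 1) k).sub (hpc j k)
      refine h1.congr (Filter.Eventually.of_forall fun ω => ?_)
      simp only [Pi.sub_apply]
      rw [powProd_succ, centeredProd_eq_mul X z (show j + 1 ≤ k by omega)]
      ring
  · intro k
    rw [← integral_add (hpc k (k + 1)) (hpow k)]
    refine integral_congr_ae (Filter.Eventually.of_forall fun ω => ?_)
    beta_reduce
    rw [powProd_succ, centeredProd_self]
    ring
  · intro j k _
    exact norm_integral_le_integral_norm _
  · intro k
    exact mul_nonneg hK0 (hν k)
  · intro k
    calc ∫ ω, ‖centeredProd X z k k ω‖ ∂P ≤ ∫ ω, c * (X k ω : ℝ) ∂P := by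
          refine integral_mono (hcent _ _).norm ((hint k).const_mul c) fun ω => ?_
          simp only
          rw [centeredProd_self]
          exact hz _ (h.bdd k ω)
      _ = c * ∫ ω, (X k ω : ℝ) ∂P := integral_const_mul _ _
      _ ≤ 3 / 4 * K * ∫ ω, (X k ω : ℝ) ∂P := by
          have := hν k
          gcongr
      _ = _ := by ring
  · intro k
    calc ∫ ω, ‖centeredProd X z k (k + 1) ω‖ ∂P
        ≤ c ^ 2 * ∫ ω, (X k ω : ℝ) * X (k + 1) ω ∂P := hQ2 k
      _ ≤ c ^ 2 * ∫ ω, C₀ * (X (k + 1) ω : ℝ) ∂P := by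
          gcongr ?_ * ?_
          refine integral_mono (h.integrable_natCast_mul _ _) ((hint _).const_mul _) fun ω => ?_
          exact mul_le_mul_of_nonneg_right (h.bdd k ω) (Nat.cast_nonneg _)
      _ = c ^ 2 * C₀ * ∫ ω, (X (k + 1) ω : ℝ) ∂P := by rw [integral_const_mul]; ring
      _ ≤ 9 / 4 * K * ∫ ω, (X (k + 1) ω : ℝ) ∂P := by
          have := hν (k + 1)
          gcongr
      _ = _ := by ring
  · intro k
    exact hQ2 k
  · intro j k hjk
    have hind := integral_mul_of_indep (A := ℝ) (h.indep j (j + 2) (by omega))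
      ((StronglyMeasurable.of_discrete (f := fun x : ℕ => (x : ℝ))).comp_measurable
        (measurable_past X le_rfl))
      (stronglyMeasurable_centeredProd X z (j + 2) k).norm (hint j) (hcent (j + 2) k).norm
    simp only [Function.comp_apply] at hind
    have hmulint : Integrable (fun ω => (X j ω : ℝ) * ‖centeredProd X z (j + 2) k ω‖) P :=
      (hcent (j + 2) k).norm.bdd_mul (c := C₀) (hint j).aestronglyMeasurable
        (Filter.Eventually.of_forall fun ω => by simpa using h.bdd j ω)
    calc ∫ ω, ‖centeredProd X z j k ω‖ ∂P
        ≤ ∫ ω, c ^ 2 * C₀ * ((X j ω : ℝ) * ‖centeredProd X z (j + 2) k ω‖) ∂P := by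
          refine integral_mono (hcent _ _).norm (hmulint.const_mul _) fun ω => ?_
          simp only
          rw [centeredProd_eq_mul X z (show j ≤ k by omega),
            centeredProd_eq_mul X z (show j + 1 ≤ k by omega)]
          calc _ ≤ ‖z ^ X j ω - 1‖ * (‖z ^ X (j + 1) ω - 1‖ * ‖centeredProd X z (j + 2) k ω‖) :=
                (norm_mul_le _ _).trans (by gcongr; exact norm_mul_le _ _)
            _ ≤ (c * X j ω) * ((c * C₀) * ‖centeredProd X z (j + 2) k ω‖) := by
                gcongr
                · exact hz _ (h.bdd _ ω)
                · exact (hz _ (h.bdd _ ω)).trans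
                    (mul_le_mul_of_nonneg_left (h.bdd _ ω) hc)
            _ = _ := by ring
      _ = c ^ 2 * C₀ * ((∫ ω, (X j ω : ℝ) ∂P) * ∫ ω, ‖centeredProd X z (j + 2) k ω‖ ∂P) := by
          rw [integral_const_mul, hind]
      _ ≤ 9 / 4 * K * ((∫ ω, (X j ω : ℝ) ∂P) * ∫ ω, ‖centeredProd X z (j + 2) k ω‖ ∂P) := by
          have h1 := hν j
          have h2 : 0 ≤ ∫ ω, ‖centeredProd X z (j + 2) k ω‖ ∂P :=
            integral_nonneg fun _ => norm_nonneg _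
          gcongr
      _ = _ := by ring

end

end Expectation

/-! ### First-order jets of generating functions -/

section Jet

/-- Dual numbers over `ℂ` with the norm `‖a + b ε‖ = ‖a‖ + ‖b‖`. They carry the value of a function
of `t` together with its derivative. -/
abbrev Jet : Type := TrivSqZeroExt ℂ ℂ

open TrivSqZeroExt

/-- The value and the `t`-derivative of `exp (h + i t)`. -/
noncomputable def jetPoint (h t : ℝ) : Jet :=
  inl (Complex.exp (h + Complex.I * t)) + inr (Complex.I * Complex.exp (h + Complex.I * t))

@[simp] lemma fst_jetPoint (h t : ℝ) :
    (jetPoint h t).fst = Complex.exp (h + Complex.I * t) := by simp [jetPoint]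

@[simp] lemma snd_jetPoint (h t : ℝ) :
    (jetPoint h t).snd = Complex.I * Complex.exp (h + Complex.I * t) := by simp [jetPoint]

lemma norm_fst_jetPoint (h t : ℝ) : ‖(jetPoint h t).fst‖ = Real.exp h := by
  simp [Complex.norm_exp]

lemma norm_snd_jetPoint (h t : ℝ) : ‖(jetPoint h t).snd‖ = Real.exp h := by
  simp [Complex.norm_exp]

lemma fst_jetPoint_pow (h t : ℝ) (x : ℕ) :
    (jetPoint h t ^ x).fst = Complex.exp (h + Complex.I * t) ^ x := by simp

lemma snd_jetPoint_pow (h t : ℝ) (x : ℕ) :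
    (jetPoint h t ^ x).snd = x * Complex.I * Complex.exp (h + Complex.I * t) ^ x := by
  rw [snd_pow]
  rcases x with _ | x
  · simp
  · simp [pow_succ]
    ring

lemma norm_fst_jetPoint_pow (h t : ℝ) (x : ℕ) : ‖(jetPoint h t ^ x).fst‖ = Real.exp (h * x) := by
  rw [fst_pow, norm_pow, norm_fst_jetPoint, ← Real.exp_nat_mul, mul_comm]

lemma norm_snd_jetPoint_pow (h t : ℝ) (x : ℕ) :
    ‖(jetPoint h t ^ x).snd‖ = x * Real.exp (h * x) := by
  rw [snd_jetPoint_pow, ← norm_fst_jetPoint_pow h t x, fst_jetPoint_pow]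
  simp

/-- Linear growth of `z ^ x - 1` in `x`, for the value and the derivative together. -/
lemma norm_jetPoint_pow_sub_one_le {h C₀ : ℝ} (hh : 0 ≤ h) (t : ℝ) {x : ℕ} (hx : (x : ℝ) ≤ C₀) :
    ‖jetPoint h t ^ x - 1‖ ≤ 3 * Real.exp (h * C₀) * x := by
  rcases Nat.eq_zero_or_pos x with rfl | hx0
  · simp
  have hx1 : (1 : ℝ) ≤ x := by exact_mod_cast hx0
  have he : Real.exp (h * x) ≤ Real.exp (h * C₀) := by gcongr
  have he1 : 1 ≤ Real.exp (h * C₀) :=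
    Real.one_le_exp (mul_nonneg hh ((Nat.cast_nonneg x).trans hx))
  have h1 : ‖(jetPoint h t ^ x - 1).fst‖ ≤ Real.exp (h * x) + 1 := by
    rw [fst_sub, fst_one, ← norm_fst_jetPoint_pow h t x]
    simpa using norm_sub_le (jetPoint h t ^ x).fst 1
  have h2 : ‖(jetPoint h t ^ x - 1).snd‖ = x * Real.exp (h * x) := by
    rw [snd_sub, snd_one, sub_zero, norm_snd_jetPoint_pow]
  rw [TrivSqZeroExt.norm_def, h2]
  nlinarith [Real.exp_pos (h * x)]

/-! ### Newton's expansion in powers of `z - 1` -/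

/-- The remainder of order `s` in Newton's expansion `z ^ x = ∑ m, x.choose m * (z - 1) ^ m`. -/
def newtonRem {R : Type*} [CommRing R] (z : R) (s x : ℕ) : R :=
  z ^ x - ∑ m ∈ Finset.range (s + 1), (x.choose m : R) * (z - 1) ^ m

lemma newtonRem_succ {R : Type*} [CommRing R] (z : R) (s x : ℕ) :
    newtonRem z s (x + 1) = z * newtonRem z s x + x.choose s * (z - 1) ^ (s + 1) := by
  have key : ∑ m ∈ Finset.range (s + 1), ((x + 1).choose m : R) * (z - 1) ^ m +
      x.choose s * (z - 1) ^ (s + 1) =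
      z * ∑ m ∈ Finset.range (s + 1), (x.choose m : R) * (z - 1) ^ m := by
    induction s with
    | zero => simp
    | succ s ih =>
      rw [Finset.sum_range_succ, Finset.sum_range_succ _ (s + 1), mul_add, ← ih,
        Nat.choose_succ_succ]
      push_cast
      ring
  rw [newtonRem, newtonRem, mul_sub, ← key]
  ring

lemma newtonRem_zero_right {R : Type*} [CommRing R] (z : R) (s : ℕ) : newtonRem z s 0 = 0 := by
  rw [newtonRem, Finset.sum_eq_single 0]
  · simp
  · intro m _ hm
    rw [Nat.choose_eq_zero_of_lt (Nat.pos_of_ne_zero hm)]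
    simp
  · simp

lemma norm_newtonRem_le {w : ℂ} {h : ℝ} (hh : 0 ≤ h) (hw : ‖w‖ = Real.exp h) (s x : ℕ) :
    ‖newtonRem w s x‖ ≤ x.choose (s + 1) * (Real.exp h + 1) ^ (s + 1) * Real.exp (h * x) := by
  induction x with
  | zero => simp [newtonRem_zero_right]
  | succ x ih =>
    have h1 : ‖w - 1‖ ≤ Real.exp h + 1 := by
      rw [← hw]; simpa using norm_sub_le w 1
    have h2 : Real.exp (h * (x + 1 : ℕ)) = Real.exp h * Real.exp (h * x) := by
      rw [← Real.exp_add]; push_cast; ring_nf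
    have h3 : 1 ≤ Real.exp h * Real.exp (h * x) := by
      rw [← Real.exp_add]; exact Real.one_le_exp (by positivity)
    rw [newtonRem_succ]
    calc _ ≤ ‖w‖ * ‖newtonRem w s x‖ + x.choose s * ‖w - 1‖ ^ (s + 1) := by
          refine (norm_add_le _ _).trans (le_of_eq ?_)
          rw [norm_mul, norm_mul, norm_pow, Complex.norm_natCast]
      _ ≤ Real.exp h * (x.choose (s + 1) * (Real.exp h + 1) ^ (s + 1) * Real.exp (h * x)) +
          x.choose s * (Real.exp h + 1) ^ (s + 1) * (Real.exp h * Real.exp (h * x)) := by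
          rw [hw]
          refine add_le_add (by gcongr) (le_trans ?_ (le_mul_of_one_le_right (by positivity) h3))
          gcongr
      _ = _ := by
          rw [h2, Nat.choose_succ_succ]
          push_cast
          ring

lemma fst_newtonRem (z : Jet) (s x : ℕ) : (newtonRem z s x).fst = newtonRem z.fst s x := by
  have : ∀ n : ℕ, (n : Jet).fst = n := fun n => by simp
  simp only [newtonRem, fst_sub, fst_pow, fst_sum, fst_mul, fst_one, this]

/-- The derivative of the Newton remainder is again a Newton remainder, of one order less. -/
lemma snd_newtonRem_succ (z : Jet) (s x : ℕ) :
    (newtonRem z (s + 1) (x + 1)).snd = (x + 1) * newtonRem z.fst s x * z.snd := by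
  have h1 : ∀ m : ℕ, (((x + 1).choose m : Jet) * (z - 1) ^ m).snd =
      (x + 1).choose m * (m * (z.fst - 1) ^ (m - 1) * z.snd) := by
    intro m
    simp [snd_mul, snd_pow]
    left
    ring
  rw [newtonRem, snd_sub, snd_sum, Finset.sum_congr rfl fun m _ => h1 m, Finset.sum_range_succ']
  have h2 : ∀ m : ℕ, ((x + 1).choose (m + 1) : ℂ) * (((m + 1 : ℕ) : ℂ) *
      (z.fst - 1) ^ (m + 1 - 1) * z.snd) =
      (x + 1) * (x.choose m * (z.fst - 1) ^ m) * z.snd := by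
    intro m
    have := Nat.add_one_mul_choose_eq x m
    have h3 : ((x : ℂ) + 1) * x.choose m = (x + 1).choose (m + 1) * ((m + 1 : ℕ) : ℂ) := by
      exact_mod_cast this
    rw [Nat.add_sub_cancel]
    linear_combination (-(z.fst - 1) ^ m * z.snd) * h3
  rw [Finset.sum_congr rfl fun m _ => h2 m, ← Finset.sum_mul, ← Finset.mul_sum, snd_pow, newtonRem]
  simp
  ring

lemma norm_snd_newtonRem_le {h : ℝ} (hh : 0 ≤ h) (t : ℝ) {s : ℕ} (hs : 1 ≤ s) (x : ℕ) :
    ‖(newtonRem (jetPoint h t) s x).snd‖ ≤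
      (s + 1) * x.choose (s + 1) * (Real.exp h + 1) ^ s * Real.exp (h * x) := by
  obtain ⟨s, rfl⟩ := Nat.exists_eq_add_of_le' hs
  rcases x with _ | x
  · simp [newtonRem_zero_right]
  rw [snd_newtonRem_succ, norm_mul, norm_mul, norm_snd_jetPoint]
  have h0 : ‖((x : ℂ) + 1)‖ = x + 1 := by
    have := Complex.norm_natCast (x + 1)
    push_cast at this
    exact this
  have h1 := norm_newtonRem_le hh (norm_fst_jetPoint h t) s x
  have h2 : Real.exp (h * (x + 1 : ℕ)) = Real.exp h * Real.exp (h * x) := by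
    rw [← Real.exp_add]; push_cast; ring_nf
  have h3 : ((x : ℝ) + 1) * x.choose (s + 1) = (x + 1).choose (s + 2) * ((s + 2 : ℕ) : ℝ) := by
    exact_mod_cast Nat.add_one_mul_choose_eq x (s + 1)
  rw [h0]
  calc _ ≤ ((x : ℝ) + 1) * (x.choose (s + 1) * (Real.exp h + 1) ^ (s + 1) * Real.exp (h * x)) *
        Real.exp h := by gcongr
    _ = (((x : ℝ) + 1) * x.choose (s + 1)) * ((Real.exp h + 1) ^ (s + 1) *
        Real.exp (h * x) * Real.exp h) := by ring
    _ = _ := by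
      rw [h3, h2]
      push_cast
      ring

/-! ### Logarithm and exponential of jets -/

/-- The logarithm of a jet: `log a + (b / a) ε` for `a + b ε`. -/
noncomputable def jetLog (r : Jet) : Jet := inl (Complex.log r.fst) + inr (r.snd / r.fst)

@[simp] lemma fst_jetLog (r : Jet) : (jetLog r).fst = Complex.log r.fst := by simp [jetLog]

@[simp] lemma snd_jetLog (r : Jet) : (jetLog r).snd = r.snd / r.fst := by simp [jetLog]

lemma norm_fst_sub_one_le (r : Jet) : ‖r.fst - 1‖ ≤ ‖r - 1‖ := by
  rw [TrivSqZeroExt.norm_def, fst_sub, fst_one]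
  linarith [norm_nonneg (r - 1).snd]

lemma fst_ne_zero_of_norm_sub_one_lt {r : Jet} (hr : ‖r - 1‖ < 1) : r.fst ≠ 0 := by
  intro h0
  have := norm_fst_sub_one_le r
  rw [h0] at this
  simp at this
  linarith

/-- The logarithm of a jet near `1` is linear up to a quadratic error. The bound `0.033` is
`3.3 / 100`, the distance from `1` of the ratios in Heinrich's recursion. -/
lemma norm_jetLog_sub_le {r : Jet} (hr : ‖r - 1‖ ≤ 0.033) :
    ‖jetLog r - (r - 1)‖ ≤ 0.52 * ‖r - 1‖ ^ 2 := by
  have hw := norm_fst_sub_one_le r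
  have h0 := fst_ne_zero_of_norm_sub_one_lt (r := r) (by linarith)
  have hdef : ‖r - 1‖ = ‖r.fst - 1‖ + ‖r.snd‖ := by
    rw [TrivSqZeroExt.norm_def]; simp
  set w := ‖r.fst - 1‖ with hwdef
  set v := ‖r.snd‖ with hvdef
  have hw0 : 0 ≤ w := norm_nonneg _
  have hv0 : 0 ≤ v := norm_nonneg _
  have hinv : (1 - w)⁻¹ ≤ 1.0342 := by
    rw [← one_div, div_le_iff₀ (by linarith)]
    linarith
  have h1 : ‖Complex.log r.fst - (r.fst - 1)‖ ≤ w ^ 2 * 1.0342 / 2 := by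
    have := Complex.norm_log_one_add_sub_self_le (z := r.fst - 1) (by linarith)
    rw [add_sub_cancel] at this
    refine this.trans ?_
    rw [← hwdef]
    gcongr
  have hlow : 1 - w ≤ ‖r.fst‖ := by
    have := norm_sub_norm_le (1 : ℂ) (1 - r.fst)
    rw [norm_sub_rev 1 r.fst, norm_one] at this
    simpa using this
  have h2 : ‖r.snd / r.fst - r.snd‖ ≤ 1.0342 * (v * w) := by
    have e : r.snd / r.fst - r.snd = (r.fst)⁻¹ * (r.snd * (1 - r.fst)) := by
      field_simp
    rw [e, norm_mul, norm_mul, norm_inv, norm_sub_rev 1 r.fst]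
    have : ‖r.fst‖⁻¹ ≤ 1.0342 := by
      refine le_trans ?_ hinv
      gcongr
      linarith
    gcongr
  rw [TrivSqZeroExt.norm_def, hdef]
  simp only [fst_sub, fst_jetLog, fst_one, snd_sub, snd_jetLog, snd_one, sub_zero]
  nlinarith [mul_nonneg hv0 hw0, mul_nonneg hv0 hv0, mul_nonneg hw0 hw0]

lemma norm_jetLog_le {r : Jet} (hr : ‖r - 1‖ ≤ 0.033) : ‖jetLog r‖ ≤ 1.02 * ‖r - 1‖ := by
  have h1 := norm_jetLog_sub_le hr
  have h2 := norm_add_le (jetLog r - (r - 1)) (r - 1)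
  rw [sub_add_cancel] at h2
  nlinarith [norm_nonneg (r - 1)]

/-- A product of jets with nonzero values is the exponential of the sum of their logarithms. -/
lemma eq_exp_sum_jetLog {f r : ℕ → Jet} (h0 : f 0 = 1) (hf : ∀ k, f (k + 1) = r k * f k)
    (hr : ∀ k, (r k).fst ≠ 0) (n : ℕ) :
    (f n).fst = Complex.exp (∑ k ∈ Finset.range n, jetLog (r k)).fst ∧
      (f n).snd = (∑ k ∈ Finset.range n, jetLog (r k)).snd *
        Complex.exp (∑ k ∈ Finset.range n, jetLog (r k)).fst := by
  induction n with
  | zero => simp [h0]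
  | succ n ih =>
    rw [hf, Finset.sum_range_succ]
    obtain ⟨ih1, ih2⟩ := ih
    have hn := hr n
    refine ⟨?_, ?_⟩
    · rw [fst_mul, ih1, fst_add, Complex.exp_add, fst_jetLog, Complex.exp_log hn, mul_comm]
    · rw [snd_mul, ih1, ih2, fst_add, Complex.exp_add, snd_add, fst_jetLog, Complex.exp_log hn]
      simp only [snd_jetLog, smul_eq_mul, MulOpposite.smul_eq_mul_unop, MulOpposite.unop_op]
      field_simp

lemma norm_exp_sub_exp_le {M : ℝ} {a b : ℂ} (ha : a.re ≤ M) (hb : b.re ≤ M) :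
    ‖Complex.exp a - Complex.exp b‖ ≤ Real.exp M * ‖a - b‖ := by
  refine (convex_halfSpace_re_le M).norm_image_sub_le_of_norm_hasDerivWithin_le
    (f := Complex.exp) (f' := Complex.exp) (fun x _ => (Complex.hasDerivAt_exp x).hasDerivWithinAt)
    (fun x hx => ?_) hb ha
  rw [Complex.norm_exp]
  exact Real.exp_le_exp.2 hx

/-- The distance between the values and between the derivatives of two exponentials. -/
lemma norm_exp_jet_sub_le {M D : ℝ} {a b : Jet} (ha : a.fst.re ≤ M) (hb : b.fst.re ≤ M)
    (hD : ‖a.snd‖ ≤ D) :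
    ‖Complex.exp a.fst - Complex.exp b.fst‖ ≤ Real.exp M * ‖(a - b).fst‖ ∧
      ‖a.snd * Complex.exp a.fst - b.snd * Complex.exp b.fst‖ ≤
        Real.exp M * (D * ‖(a - b).fst‖ + ‖(a - b).snd‖) := by
  have h1 := norm_exp_sub_exp_le ha hb
  have h2 : a.snd * Complex.exp a.fst - b.snd * Complex.exp b.fst =
      a.snd * (Complex.exp a.fst - Complex.exp b.fst) +
        (a.snd - b.snd) * Complex.exp b.fst := by ring
  have h3 : ‖Complex.exp b.fst‖ ≤ Real.exp M := by
    rw [Complex.norm_exp]; exact Real.exp_le_exp.2 hb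
  rw [h2, fst_sub, snd_sub]
  have hD0 : 0 ≤ D := (norm_nonneg _).trans hD
  refine ⟨h1, ?_⟩
  calc _ ≤ D * (Real.exp M * ‖a.fst - b.fst‖) + ‖a.snd - b.snd‖ * Real.exp M := by
        refine (norm_add_le _ _).trans ?_
        rw [norm_mul, norm_mul]
        gcongr
    _ = _ := by ring

end Jet

/-! ### Generating function of the compound Poisson distribution -/

section CompoundPoisson

lemma integrable_pow_poissonMeasure (r : ℝ≥0) (u : ℂ) :
    Integrable (fun n : ℕ => u ^ n) (poissonMeasure r) := by
  rw [integrable_poissonMeasure_iff]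
  have h := (Real.summable_pow_div_factorial ((r : ℝ) * ‖u‖)).mul_left (Real.exp (-r))
  refine h.congr fun n => ?_
  rw [norm_pow, mul_pow]
  ring

lemma integral_pow_poissonMeasure (r : ℝ≥0) (u : ℂ) :
    ∫ n : ℕ, u ^ n ∂poissonMeasure r = Complex.exp (r * (u - 1)) := by
  have h1 := hasSum_integral_poissonMeasure (integrable_pow_poissonMeasure r u)
  have h2 := (NormedSpace.expSeries_div_hasSum_exp (𝔸 := ℂ) ((r : ℂ) * u)).mul_left
    (Complex.exp (-r))
  rw [← Complex.exp_eq_exp_ℂ, ← Complex.exp_add] at h2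
  have h3 := h1.unique (h2.congr_fun ?_)
  · rw [h3]; ring_nf
  · intro n
    rw [Complex.real_smul]
    push_cast
    rw [mul_pow]
    ring

lemma pow_sum_mul_eq_prod (s : ℕ) (w : ℂ) (N : Finset.Icc 1 s → ℕ) :
    w ^ (∑ i : Finset.Icc 1 s, (i : ℕ) * N i) = ∏ i : Finset.Icc 1 s, (w ^ (i : ℕ)) ^ N i := by
  rw [← Finset.prod_pow_eq_pow_sum]
  simp_rw [pow_mul]

lemma integrable_pow_compoundPoisson (s : ℕ) (lam : ℕ → ℝ≥0) (w : ℂ) :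
    Integrable (fun k : ℕ => w ^ k) (compoundPoisson s lam) := by
  rw [compoundPoisson, integrable_map_measure .of_discrete Measurable.of_discrete.aemeasurable]
  simp only [Function.comp_def, pow_sum_mul_eq_prod]
  exact Integrable.fintype_prod_dep fun i => integrable_pow_poissonMeasure _ _

lemma integral_pow_compoundPoisson (s : ℕ) (lam : ℕ → ℝ≥0) (w : ℂ) :
    ∫ k : ℕ, w ^ k ∂compoundPoisson s lam =
      Complex.exp (∑ m ∈ Finset.Icc 1 s, (lam m : ℂ) * (w ^ m - 1)) := by
  rw [compoundPoisson, integral_map Measurable.of_discrete.aemeasurable .of_discrete]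
  simp only [pow_sum_mul_eq_prod]
  rw [integral_fintype_prod_eq_prod]
  simp only [integral_pow_poissonMeasure]
  rw [← Complex.exp_sum, Finset.sum_coe_sort (Finset.Icc 1 s)
    (fun m => (lam m : ℂ) * (w ^ m - 1))]

lemma integrable_natCast_mul_pow_compoundPoisson (s : ℕ) (lam : ℕ → ℝ≥0) (w : ℂ) :
    Integrable (fun k : ℕ => (k : ℂ) * w ^ k) (compoundPoisson s lam) := by
  -- `k ≤ 2 ^ k`
  refine (integrable_pow_compoundPoisson s lam (2 * w)).mono .of_discrete
    (Filter.Eventually.of_forall fun k => ?_)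
  rw [norm_mul, mul_pow, norm_mul]
  have : ‖(k : ℂ)‖ ≤ ‖(2 : ℂ) ^ k‖ := by
    rw [Complex.norm_natCast, norm_pow, Complex.norm_ofNat]
    exact_mod_cast Nat.lt_two_pow_self.le
  gcongr

/-- Differentiation of `integral_pow_compoundPoisson` in `t`, where `w = exp (h + i t)`. -/
lemma integral_natCast_mul_pow_compoundPoisson (s : ℕ) (lam : ℕ → ℝ≥0) (h t : ℝ) :
    ∫ k : ℕ, k * Complex.I * Complex.exp (h + Complex.I * t) ^ k ∂compoundPoisson s lam =
      (∑ m ∈ Finset.Icc 1 s, (lam m : ℂ) * (m * Complex.I * Complex.exp (h + Complex.I * t) ^ m)) *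
        Complex.exp (∑ m ∈ Finset.Icc 1 s,
          (lam m : ℂ) * (Complex.exp (h + Complex.I * t) ^ m - 1)) := by
  have hw : ∀ (k : ℕ) (t : ℝ), HasDerivAt
      (fun t : ℝ => Complex.exp (h + Complex.I * t) ^ k)
      (k * Complex.I * Complex.exp (h + Complex.I * t) ^ k) t := by
    intro k t
    have h1 : HasDerivAt (fun t : ℝ => (h : ℂ) + Complex.I * t) Complex.I t := by
      simpa using ((Complex.ofRealCLM.hasDerivAt (x := t)).const_mul Complex.I).const_add (h : ℂ)
    refine (h1.cexp.fun_pow k).congr_deriv ?_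
    rcases k with _ | k
    · simp
    · rw [Nat.add_sub_cancel]; ring
  have hnorm : ∀ (k : ℕ) (t : ℝ), ‖(k : ℂ) * Complex.I * Complex.exp (h + Complex.I * t) ^ k‖ =
      ‖(k : ℂ) * Complex.exp h ^ k‖ := by
    intro k t
    simp [Complex.norm_exp]
  have hL := hasDerivAt_integral_of_dominated_loc_of_deriv_le (μ := compoundPoisson s lam)
    (F := fun (t : ℝ) (k : ℕ) => Complex.exp (h + Complex.I * t) ^ k)
    (F' := fun (t : ℝ) (k : ℕ) => k * Complex.I * Complex.exp (h + Complex.I * t) ^ k)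
    (x₀ := t) (s := Set.univ) (bound := fun k => ‖(k : ℂ) * Complex.exp h ^ k‖)
    Filter.univ_mem (Filter.Eventually.of_forall fun _ => .of_discrete)
    (integrable_pow_compoundPoisson s lam _) .of_discrete
    (Filter.Eventually.of_forall fun k x _ => (hnorm k x).le)
    (integrable_natCast_mul_pow_compoundPoisson s lam _).norm
    (Filter.Eventually.of_forall fun k x _ => hw k x)
  have hR : HasDerivAt (fun t : ℝ => Complex.exp (∑ m ∈ Finset.Icc 1 s,
      (lam m : ℂ) * (Complex.exp (h + Complex.I * t) ^ m - 1))) _ t :=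
    (HasDerivAt.fun_sum fun m _ => ((hw m t).sub_const 1).const_mul (lam m : ℂ)).cexp
  have hL2 := hL.2
  simp only [integral_pow_compoundPoisson] at hL2
  rw [hL2.unique hR, mul_comm]

/-- The exponent of the generating function of the compound Poisson distribution. -/
noncomputable def cpExponent (s : ℕ) (lam : ℕ → ℝ≥0) (z : Jet) : Jet :=
  ∑ m ∈ Finset.Icc 1 s, (lam m : ℝ) • (z ^ m - 1)

lemma fst_cpExponent (s : ℕ) (lam : ℕ → ℝ≥0) (h t : ℝ) :
    (cpExponent s lam (jetPoint h t)).fst =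
      ∑ m ∈ Finset.Icc 1 s, (lam m : ℂ) * (Complex.exp (h + Complex.I * t) ^ m - 1) := by
  simp [cpExponent, TrivSqZeroExt.fst_sum]

lemma snd_cpExponent (s : ℕ) (lam : ℕ → ℝ≥0) (h t : ℝ) :
    (cpExponent s lam (jetPoint h t)).snd = ∑ m ∈ Finset.Icc 1 s,
      (lam m : ℂ) * (m * Complex.I * Complex.exp (h + Complex.I * t) ^ m) := by
  simp only [cpExponent, TrivSqZeroExt.snd_sum, TrivSqZeroExt.snd_smul, TrivSqZeroExt.snd_sub,
    TrivSqZeroExt.snd_one, sub_zero, snd_jetPoint_pow, Complex.real_smul]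

lemma re_fst_cpExponent_le (s : ℕ) (lam : ℕ → ℝ≥0) (h t : ℝ) :
    (cpExponent s lam (jetPoint h t)).fst.re ≤
      ∑ m ∈ Finset.Icc 1 s, (lam m : ℝ) * (Real.exp (h * m) + 1) := by
  rw [fst_cpExponent, Complex.re_sum]
  refine Finset.sum_le_sum fun m _ => (Complex.re_le_norm _).trans ?_
  rw [norm_mul]
  have h1 : ‖Complex.exp (h + Complex.I * t) ^ m‖ = Real.exp (h * m) := by
    rw [← fst_jetPoint_pow, norm_fst_jetPoint_pow]
  have h2 := norm_sub_le (Complex.exp (h + Complex.I * t) ^ m) 1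
  rw [h1, norm_one] at h2
  have h3 : ‖((lam m : ℝ) : ℂ)‖ = lam m := by simp
  exact mul_le_mul h3.le h2 (norm_nonneg _) (NNReal.coe_nonneg _)

end CompoundPoisson

/-! ### Distance between distributions on `ℕ` -/

section Distance

lemma hasSum_integral_nat {E : Type*} [NormedAddCommGroup E] [NormedSpace ℝ E] [CompleteSpace E]
    {μ : Measure ℕ} {f : ℕ → E} (hf : Integrable f μ) :
    HasSum (fun k => μ.real {k} • f k) (∫ k, f k ∂μ) := by
  have hf' := hf
  rw [← Measure.sum_smul_dirac μ] at hf'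
  have h1 := hasSum_integral_measure hf'
  simp only [integral_smul_measure, integral_dirac, Measure.sum_smul_dirac] at h1
  exact h1

/-- Bounds for the difference of two generating functions on the circle of radius `e ^ h` and for
its derivative bound the exponentially weighted distance of the distributions. -/
theorem summable_and_tsum_exp_mul_abs_sub_le {μ ν : Measure ℕ} {h : ℝ}
    (hμ : Integrable (fun k : ℕ => Complex.exp h ^ k) μ)
    (hν : Integrable (fun k : ℕ => Complex.exp h ^ k) ν)
    (hμ' : Integrable (fun k : ℕ => (k : ℂ) * Complex.exp h ^ k) μ)
    (hν' : Integrable (fun k : ℕ => (k : ℂ) * Complex.exp h ^ k) ν) {M₀ M₁ : ℝ}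
    (h₀ : ∀ t : ℝ, ‖∫ k : ℕ, Complex.exp (h + Complex.I * t) ^ k ∂μ -
      ∫ k : ℕ, Complex.exp (h + Complex.I * t) ^ k ∂ν‖ ≤ M₀)
    (h₁ : ∀ t : ℝ, ‖∫ k : ℕ, k * Complex.I * Complex.exp (h + Complex.I * t) ^ k ∂μ -
      ∫ k : ℕ, k * Complex.I * Complex.exp (h + Complex.I * t) ^ k ∂ν‖ ≤ M₁) :
    Summable (fun k : ℕ => Real.exp (h * k) * |μ.real {k} - ν.real {k}|) ∧
      ∑' k : ℕ, Real.exp (h * k) * |μ.real {k} - ν.real {k}| ≤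
        √(1 + Real.pi ^ 2 / 6) * (M₀ + M₁) := by
  set u : ℕ → ℂ := fun k => ((μ.real {k} - ν.real {k} : ℝ) : ℂ) * Complex.exp h ^ k with hu
  have hexp : ∀ k : ℕ, Complex.exp h ^ k = ((Real.exp (h * k) : ℝ) : ℂ) := by
    intro k
    rw [← Complex.exp_nat_mul]; push_cast; ring_nf
  have hnorm : ∀ k : ℕ, ‖u k‖ = Real.exp (h * k) * |μ.real {k} - ν.real {k}| := by
    intro k
    rw [hu]
    beta_reduce
    rw [hexp, norm_mul, Complex.norm_real, Complex.norm_real, Real.norm_eq_abs, Real.norm_eq_abs,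
      Real.abs_exp, mul_comm]
  have hrot : ∀ (k : ℕ) (t : ℝ), Complex.exp (h + Complex.I * t) ^ k =
      Complex.exp h ^ k * Complex.exp (Complex.I * k * t) := by
    intro k t
    rw [← Complex.exp_nat_mul, ← Complex.exp_nat_mul, ← Complex.exp_add]; ring_nf
  have hnw : ∀ (k : ℕ) (t : ℝ), ‖Complex.exp h ^ k‖ = ‖Complex.exp (h + Complex.I * t) ^ k‖ := by
    intro k t; simp [Complex.norm_exp]
  have hI : ∀ {ρ : Measure ℕ}, Integrable (fun k : ℕ => Complex.exp h ^ k) ρ → ∀ t : ℝ,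
      Integrable (fun k : ℕ => Complex.exp (h + Complex.I * t) ^ k) ρ := fun hρ t =>
    hρ.mono .of_discrete (Filter.Eventually.of_forall fun k => (hnw k t).ge)
  have hI' : ∀ {ρ : Measure ℕ}, Integrable (fun k : ℕ => (k : ℂ) * Complex.exp h ^ k) ρ →
      ∀ t : ℝ, Integrable (fun k : ℕ => k * Complex.I * Complex.exp (h + Complex.I * t) ^ k) ρ :=
    fun hρ t => hρ.mono .of_discrete (Filter.Eventually.of_forall fun k => by
      rw [norm_mul, norm_mul, norm_mul, Complex.norm_I, mul_one, hnw k t])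
  have e0 : ∀ t : ℝ, HasSum (fun k => u k * Complex.exp (Complex.I * k * t))
      (∫ k : ℕ, Complex.exp (h + Complex.I * t) ^ k ∂μ -
        ∫ k : ℕ, Complex.exp (h + Complex.I * t) ^ k ∂ν) := by
    intro t
    refine ((hasSum_integral_nat (hI hμ t)).sub (hasSum_integral_nat (hI hν t))).congr_fun
      fun k => ?_
    rw [hrot, hu, Complex.real_smul, Complex.real_smul]
    push_cast
    ring
  have e1 : ∀ t : ℝ, HasSum (fun k : ℕ => Complex.I * ((k : ℂ) * u k * Complex.exp (Complex.I * k * t)))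
      (∫ k : ℕ, k * Complex.I * Complex.exp (h + Complex.I * t) ^ k ∂μ -
        ∫ k : ℕ, k * Complex.I * Complex.exp (h + Complex.I * t) ^ k ∂ν) := by
    intro t
    refine ((hasSum_integral_nat (hI' hμ' t)).sub (hasSum_integral_nat (hI' hν' t))).congr_fun
      fun k => ?_
    rw [hrot, hu, Complex.real_smul, Complex.real_smul]
    push_cast
    ring
  have s0 : Summable fun k => ‖u k‖ := by
    simpa using (e0 0).summable.norm
  have s1 : Summable fun k : ℕ => ‖(k : ℂ) * u k‖ := by
    simpa using (e1 0).summable.norm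
  have hmain := sum_norm_le_of_norm_tsum_le s0 s1 (M₀ := M₀) (M₁ := M₁)
    (fun t => by rw [(e0 t).tsum_eq]; exact h₀ t)
    (fun t => by
      have := h₁ t
      rw [← (e1 t).tsum_eq, tsum_mul_left, norm_mul, Complex.norm_I, one_mul] at this
      exact this)
  simp_rw [hnorm] at s0 hmain
  exact ⟨s0, hmain⟩

end Distance

/-! ### The generating function of the sum -/

section Sum

open TrivSqZeroExt

lemma sum_Icc_one_eq_sum_range {M : Type*} [AddCommMonoid M] (g : ℕ → M) (n : ℕ) :
    ∑ k ∈ Finset.Icc 1 n, g k = ∑ k ∈ Finset.range n, g (k + 1) := by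
  rw [Finset.range_eq_Ico, Finset.sum_Ico_add' g 0 n 1]
  rfl

lemma newtonRem_eq_zero {R : Type*} [CommRing R] (z : R) {s x : ℕ} (hx : x ≤ s) :
    newtonRem z s x = 0 := by
  induction x with
  | zero => exact newtonRem_zero_right z s
  | succ x ih =>
    rw [newtonRem_succ, ih (by omega), Nat.choose_eq_zero_of_lt (by omega)]
    simp

lemma pow_sub_one_eq {R : Type*} [CommRing R] (z : R) (s x : ℕ) :
    z ^ x - 1 = ∑ m ∈ Finset.Icc 1 s, (x.choose m : R) * (z - 1) ^ m + newtonRem z s x := by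
  rw [newtonRem, Finset.sum_range_succ', sum_Icc_one_eq_sum_range]
  simp
  ring

lemma powProd_eq_pow_partialSum {Ω A : Type*} [NormedCommRing A] {X : ℕ → Ω → ℕ}
    (hX : ∀ ω, X 0 ω = 0) (z : A) (n : ℕ) (ω : Ω) :
    powProd X z n ω = z ^ partialSum X n ω := by
  rw [powProd, partialSum, Finset.prod_pow_eq_pow_sum, Finset.sum_range_succ', hX,
    sum_Icc_one_eq_sum_range, add_zero]

/-- The remainder terms of the ratios, summed up. The products of neighbouring means are absorbed
into the sum of squares. -/
lemma sum_ratio_error_le {ν c p e : ℕ → ℝ} {a : ℝ} (ha : 2 ≤ a) (hν0 : ν 0 = 0)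
    (hc : ∀ k, 0 ≤ c k) (hν : ∀ k, 0 ≤ ν k)
    (hp : ∀ k, p (k + 1) ≤ 9 / 4 * a ^ 2 * (c (k + 1) + ν k * ν (k + 1)))
    (he : ∀ k, e k ≤ 0.52 * (3.3 * (a ^ 2 * ν (k + 1))) ^ 2 +
      (2.6 * (a ^ 2 * ν k) * (a ^ 2 * ν (k + 1)) + 1.097 * p (k + 1) +
        1.92 * (a ^ 2 * ν (k - 1)) * (a ^ 2 * ν (k + 1)))) (n : ℕ) :
    ∑ k ∈ Finset.range n, e k ≤ 11 * a ^ 4 * ∑ k ∈ Finset.range n, ν (k + 1) ^ 2 +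
      1.25 * a ^ 3 * ∑ k ∈ Finset.range n, c (k + 1) := by
  have hV1 : ∑ k ∈ Finset.range n, ν k ^ 2 ≤ ∑ k ∈ Finset.range n, ν (k + 1) ^ 2 := by
    have := Finset.sum_range_succ' (fun k => ν k ^ 2) n
    rw [Finset.sum_range_succ, hν0] at this
    nlinarith [sq_nonneg (ν n)]
  have hV2 : ∑ k ∈ Finset.range n, ν (k - 1) ^ 2 ≤ ∑ k ∈ Finset.range n, ν (k + 1) ^ 2 := by
    refine le_trans ?_ hV1
    rcases n with _ | n
    · simp
    · rw [Finset.sum_range_succ', Finset.sum_range_succ]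
      simp only [Nat.add_sub_cancel, Nat.zero_sub, hν0]
      nlinarith [sq_nonneg (ν n)]
  have hterm : ∀ k, e k ≤ a ^ 4 * (8.24 * ν (k + 1) ^ 2 + 1.61 * ν k ^ 2 + 0.96 * ν (k - 1) ^ 2) +
      1.25 * a ^ 3 * c (k + 1) := by
    intro k
    have h2 : 2 * a ^ 2 ≤ a ^ 3 := by nlinarith [sq_nonneg a]
    have h4 : 4 * a ^ 2 ≤ a ^ 4 := by nlinarith [mul_nonneg (sq_nonneg a) (sq_nonneg a)]
    have h5 : 0 ≤ a ^ 4 := by positivity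
    have q1 : ν k * ν (k + 1) ≤ (ν k ^ 2 + ν (k + 1) ^ 2) / 2 := by
      nlinarith [sq_nonneg (ν k - ν (k + 1))]
    have q2 : ν (k - 1) * ν (k + 1) ≤ (ν (k - 1) ^ 2 + ν (k + 1) ^ 2) / 2 := by
      nlinarith [sq_nonneg (ν (k - 1) - ν (k + 1))]
    have q3 := mul_le_mul_of_nonneg_right h2 (hc (k + 1))
    have q4 := mul_le_mul_of_nonneg_right h4 (mul_nonneg (hν k) (hν (k + 1)))
    have q5 := mul_le_mul_of_nonneg_left q1 h5
    have q6 := mul_le_mul_of_nonneg_left q2 h5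
    have q7 : 0 ≤ a ^ 4 * ν (k + 1) ^ 2 := by positivity
    have q8 : 0 ≤ a ^ 4 * ν k ^ 2 := by positivity
    have q9 : 0 ≤ a ^ 3 * c (k + 1) := mul_nonneg (by positivity) (hc _)
    refine (he k).trans ?_
    have e1 : (3.3 * (a ^ 2 * ν (k + 1))) ^ 2 = 10.89 * (a ^ 4 * ν (k + 1) ^ 2) := by ring
    have e2 : 2.6 * (a ^ 2 * ν k) * (a ^ 2 * ν (k + 1)) =
        2.6 * (a ^ 4 * (ν k * ν (k + 1))) := by ring
    have e3 : 1.92 * (a ^ 2 * ν (k - 1)) * (a ^ 2 * ν (k + 1)) =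
        1.92 * (a ^ 4 * (ν (k - 1) * ν (k + 1))) := by ring
    rw [e1, e2, e3]
    have := hp k
    linarith
  refine (Finset.sum_le_sum fun k _ => hterm k).trans ?_
  rw [Finset.sum_add_distrib, ← Finset.mul_sum, ← Finset.mul_sum]
  simp only [Finset.sum_add_distrib, ← Finset.mul_sum]
  have h5 : 0 ≤ a ^ 4 := by positivity
  have g1 := mul_le_mul_of_nonneg_left hV1 h5
  have g2 := mul_le_mul_of_nonneg_left hV2 h5
  have g3 : 0 ≤ a ^ 4 * ∑ k ∈ Finset.range n, ν (k + 1) ^ 2 := by positivity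
  linarith

variable {Ω : Type*} {mΩ : MeasurableSpace Ω} {P : Measure Ω}

lemma fst_integral_jet {F : Ω → Jet} (hF : Integrable F P) :
    (∫ ω, F ω ∂P).fst = ∫ ω, (F ω).fst ∂P :=
  ((fstCLM ℂ ℂ).integral_comp_comm hF).symm

lemma snd_integral_jet {F : Ω → Jet} (hF : Integrable F P) :
    (∫ ω, F ω ∂P).snd = ∫ ω, (F ω).snd ∂P :=
  ((sndCLM ℂ ℂ).integral_comp_comm hF).symm

variable [IsProbabilityMeasure P] {X : ℕ → Ω → ℕ} {C₀ : ℝ}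

lemma factMoment_eq_factorial_mul (P : Measure Ω) (X : ℕ → Ω → ℕ) (m k : ℕ) :
    factMoment P X m k = m.factorial * ∫ ω, ((X k ω).choose m : ℝ) ∂P := by
  rw [factMoment, ← integral_const_mul]
  simp only [Nat.descFactorial_eq_factorial_mul_choose, Nat.cast_mul]

lemma factMoment_one (P : Measure Ω) (X : ℕ → Ω → ℕ) (k : ℕ) :
    factMoment P X 1 k = ∫ ω, (X k ω : ℝ) ∂P := by
  simp [factMoment]

lemma factMoment_nonneg (P : Measure Ω) (X : ℕ → Ω → ℕ) (m k : ℕ) : 0 ≤ factMoment P X m k :=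
  integral_nonneg fun _ => Nat.cast_nonneg _

/-- Newton's expansion in mean. -/
lemma BddOneDep.integral_pow_sub_one (hX : BddOneDep P X C₀) (z : Jet) (s k : ℕ) :
    ∫ ω, (z ^ X k ω - 1) ∂P =
      ∑ m ∈ Finset.Icc 1 s, (1 / (m.factorial : ℝ) * factMoment P X m k) • (z - 1) ^ m +
        ∫ ω, newtonRem z s (X k ω) ∂P := by
  simp only [pow_sub_one_eq z s]
  rw [integral_add (hX.integrable_comp k fun x =>
      ∑ m ∈ Finset.Icc 1 s, (x.choose m : Jet) * (z - 1) ^ m)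
    (hX.integrable_comp k fun x => newtonRem z s x),
    integral_finsetSum _ fun m _ => hX.integrable_comp k fun x => (x.choose m : Jet) * (z - 1) ^ m]
  congr 1
  refine Finset.sum_congr rfl fun m _ => ?_
  have h1 : ∀ x : ℕ, (x.choose m : Jet) * (z - 1) ^ m = (x.choose m : ℝ) • (z - 1) ^ m := by
    intro x
    rw [← nsmul_eq_mul, Nat.cast_smul_eq_nsmul]
  simp only [h1]
  rw [integral_smul_const, factMoment_eq_factorial_mul, one_div, inv_mul_cancel_left₀]
  exact_mod_cast m.factorial_ne_zero

lemma cpExponent_eq (z : Jet) (s : ℕ) (lam : ℕ → ℝ≥0) :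
    cpExponent s lam z = ∑ m ∈ Finset.Icc 1 s,
      (∑ l ∈ Finset.Icc m s, (l.choose m : ℝ) * (lam l : ℝ)) • (z - 1) ^ m := by
  have h1 : ∀ l ∈ Finset.Icc 1 s, (lam l : ℝ) • (z ^ l - 1) =
      ∑ m ∈ Finset.Icc 1 s, ((l.choose m : ℝ) * (lam l : ℝ)) • (z - 1) ^ m := by
    intro l hl
    rw [pow_sub_one_eq z s, newtonRem_eq_zero z (Finset.mem_Icc.1 hl).2, add_zero,
      Finset.smul_sum]
    refine Finset.sum_congr rfl fun m _ => ?_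
    rw [mul_comm (l.choose m : ℝ), mul_smul, Nat.cast_smul_eq_nsmul, nsmul_eq_mul]
  rw [cpExponent, Finset.sum_congr rfl h1, Finset.sum_comm]
  refine Finset.sum_congr rfl fun m hm => ?_
  rw [← Finset.sum_smul]
  congr 1
  symm
  refine Finset.sum_subset (Finset.Icc_subset_Icc_left (Finset.mem_Icc.1 hm).1) fun l hl hl' => ?_
  rw [Finset.mem_Icc] at hl hl'
  rw [Nat.choose_eq_zero_of_lt (by omega)]
  simp

/-- `|∑ⱼ ν_m(j) / m! - ∑ₗ (l choose m) λ_l|`, summed over `m ≤ s`. -/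
noncomputable def momentGap (P : Measure Ω) (X : ℕ → Ω → ℕ) (n s : ℕ) (lam : ℕ → ℝ≥0) : ℝ :=
  ∑ m ∈ Finset.Icc 1 s,
    |1 / (m.factorial : ℝ) * ∑ j ∈ Finset.Icc 1 n, factMoment P X m j -
      ∑ l ∈ Finset.Icc m s, (l.choose m : ℝ) * (lam l : ℝ)|

/-- A bound for the mean of the Newton remainder and for its derivative. -/
lemma BddOneDep.norm_integral_newtonRem_le (hX : BddOneDep P X C₀) {h : ℝ} (hh : 0 ≤ h) (t : ℝ)
    {s : ℕ} (hs : 1 ≤ s) (k : ℕ) :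
    ‖(∫ ω, newtonRem (jetPoint h t) s (X k ω) ∂P).fst‖ ≤
        Real.exp (h * C₀) * (Real.exp h + 1) ^ (s + 1) / ((s + 1).factorial : ℝ) *
          factMoment P X (s + 1) k ∧
      ‖(∫ ω, newtonRem (jetPoint h t) s (X k ω) ∂P).snd‖ ≤
        s * (Real.exp (h * C₀) * (Real.exp h + 1) ^ (s + 1) / ((s + 1).factorial : ℝ) *
          factMoment P X (s + 1) k) := by
  have hint : Integrable (fun ω => newtonRem (jetPoint h t) s (X k ω)) P :=
    hX.integrable_comp k fun x => newtonRem (jetPoint h t) s x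
  have hch : Integrable (fun ω => ((X k ω).choose (s + 1) : ℝ)) P :=
    hX.integrable_comp k fun x => (x.choose (s + 1) : ℝ)
  have he : ∀ ω, Real.exp (h * X k ω) ≤ Real.exp (h * C₀) := fun ω => by
    have := hX.bdd k ω
    gcongr
  have hfac : ((s + 1).factorial : ℝ) ≠ 0 := by exact_mod_cast (s + 1).factorial_ne_zero
  have hE1 : 1 ≤ Real.exp h := Real.one_le_exp hh
  have hs' : (1 : ℝ) ≤ s := by exact_mod_cast hs
  have hR : Real.exp (h * C₀) * (Real.exp h + 1) ^ (s + 1) / ((s + 1).factorial : ℝ) *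
      factMoment P X (s + 1) k =
      ((Real.exp h + 1) ^ (s + 1) * Real.exp (h * C₀)) *
        ∫ ω, ((X k ω).choose (s + 1) : ℝ) ∂P := by
    rw [factMoment_eq_factorial_mul]
    field_simp
  rw [hR, ← integral_const_mul, ← integral_const_mul, fst_integral_jet hint, snd_integral_jet hint]
  constructor
  · refine norm_integral_le_of_norm_le (hch.const_mul _) (Filter.Eventually.of_forall fun ω => ?_)
    rw [fst_newtonRem]
    refine (norm_newtonRem_le hh (norm_fst_jetPoint h t) s (X k ω)).trans ?_
    calc _ ≤ ((X k ω).choose (s + 1) : ℝ) * (Real.exp h + 1) ^ (s + 1) * Real.exp (h * C₀) := by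
          have := he ω
          gcongr
      _ = _ := by ring
  · refine norm_integral_le_of_norm_le ((hch.const_mul _).const_mul _)
      (Filter.Eventually.of_forall fun ω => ?_)
    refine (norm_snd_newtonRem_le hh t hs (X k ω)).trans ?_
    -- `s + 1 ≤ 2 s ≤ s (e ^ h + 1)`
    have h1 : (s : ℝ) + 1 ≤ s * (Real.exp h + 1) := by nlinarith
    calc _ ≤ (s * (Real.exp h + 1)) * (X k ω).choose (s + 1) * (Real.exp h + 1) ^ s *
          Real.exp (h * C₀) := by
          have := he ω
          gcongr
      _ = _ := by ring

/-- Values and derivatives of the difference between the sum of the first-order terms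
`E z ^ X k - 1` and the exponent of the compound Poisson distribution. -/
lemma BddOneDep.norm_sum_sub_cpExponent_le (hX : BddOneDep P X C₀) {h : ℝ} (hh : 0 ≤ h) (t : ℝ)
    {s : ℕ} (hs : 1 ≤ s) (lam : ℕ → ℝ≥0) (n : ℕ) {E : ℝ}
    (hE : E = (Real.exp h + 1) ^ s * momentGap P X n s lam +
      Real.exp (h * C₀) * (Real.exp h + 1) ^ (s + 1) / ((s + 1).factorial : ℝ) *
        ∑ j ∈ Finset.Icc 1 n, factMoment P X (s + 1) j) :
    ‖(∑ k ∈ Finset.Icc 1 n, ∫ ω, (jetPoint h t ^ X k ω - 1) ∂P -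
        cpExponent s lam (jetPoint h t)).fst‖ ≤ E ∧
      ‖(∑ k ∈ Finset.Icc 1 n, ∫ ω, (jetPoint h t ^ X k ω - 1) ∂P -
        cpExponent s lam (jetPoint h t)).snd‖ ≤ s * E := by
  set z := jetPoint h t with hz
  set Δ : ℕ → ℝ := fun m => 1 / (m.factorial : ℝ) * ∑ j ∈ Finset.Icc 1 n, factMoment P X m j -
      ∑ l ∈ Finset.Icc m s, (l.choose m : ℝ) * (lam l : ℝ) with hΔ
  have hdecomp : ∑ k ∈ Finset.Icc 1 n, ∫ ω, (z ^ X k ω - 1) ∂P - cpExponent s lam z =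
      ∑ m ∈ Finset.Icc 1 s, Δ m • (z - 1) ^ m +
        ∑ k ∈ Finset.Icc 1 n, ∫ ω, newtonRem z s (X k ω) ∂P := by
    simp only [hX.integral_pow_sub_one z s, cpExponent_eq, Finset.sum_add_distrib, hΔ, sub_smul,
      Finset.sum_sub_distrib, Finset.mul_sum, Finset.sum_smul]
    rw [Finset.sum_comm]
    abel
  have hw : ‖(z - 1).fst‖ ≤ Real.exp h + 1 := by
    rw [fst_sub, fst_one, ← norm_fst_jetPoint h t]
    exact (norm_sub_le z.fst 1).trans_eq (by rw [norm_one])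
  have hE1 : 1 ≤ Real.exp h + 1 := by linarith [Real.exp_pos h]
  have hfst : ∀ m ∈ Finset.Icc 1 s, ‖(Δ m • (z - 1) ^ m).fst‖ ≤ (Real.exp h + 1) ^ s * |Δ m| := by
    intro m hm
    rw [fst_smul, norm_smul, fst_pow, norm_pow, Real.norm_eq_abs, mul_comm]
    gcongr
    exact (by gcongr : _ ≤ _).trans (pow_le_pow_right₀ hE1 (Finset.mem_Icc.1 hm).2)
  have hsnd : ∀ m ∈ Finset.Icc 1 s,
      ‖(Δ m • (z - 1) ^ m).snd‖ ≤ s * ((Real.exp h + 1) ^ s * |Δ m|) := by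
    intro m hm
    obtain ⟨hm1, hm2⟩ := Finset.mem_Icc.1 hm
    obtain ⟨m, rfl⟩ := Nat.exists_eq_add_of_le' hm1
    have hz2 : ‖(z - 1).snd‖ ≤ Real.exp h + 1 := by
      rw [snd_sub, snd_one, sub_zero, hz, norm_snd_jetPoint]
      linarith
    have h1 : ‖((z - 1) ^ (m + 1)).snd‖ ≤ s * (Real.exp h + 1) ^ s := by
      have hms : ((m + 1 : ℕ) : ℝ) ≤ s := by exact_mod_cast hm2
      rw [snd_pow, Nat.pred_succ, ← Nat.cast_smul_eq_nsmul ℝ, norm_smul, norm_smul, norm_pow,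
        Real.norm_natCast]
      calc ((m + 1 : ℕ) : ℝ) * (‖(z - 1).fst‖ ^ m * ‖(z - 1).snd‖)
          ≤ s * ((Real.exp h + 1) ^ m * (Real.exp h + 1)) := by gcongr
        _ = s * (Real.exp h + 1) ^ (m + 1) := by ring
        _ ≤ _ := by gcongr
    rw [snd_smul, norm_smul, Real.norm_eq_abs]
    calc _ ≤ |Δ (m + 1)| * (s * (Real.exp h + 1) ^ s) := by gcongr
      _ = _ := by ring
  have hrem := fun k => hX.norm_integral_newtonRem_le hh t hs k
  rw [hdecomp, fst_add, snd_add, fst_sum, fst_sum, snd_sum, snd_sum, hE, momentGap, Finset.mul_sum,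
    Finset.mul_sum, mul_add, Finset.mul_sum, Finset.mul_sum]
  exact ⟨norm_add_le_of_le (norm_sum_le_of_le _ hfst)
      (norm_sum_le_of_le _ fun k _ => (hrem k).1),
    norm_add_le_of_le (norm_sum_le_of_le _ hsnd) (norm_sum_le_of_le _ fun k _ => (hrem k).2)⟩

end Sum

/-! ### Comparison with the compound Poisson distribution -/

section Comparison

open TrivSqZeroExt

variable {Ω : Type*} {mΩ : MeasurableSpace Ω} {P : Measure Ω} [IsProbabilityMeasure P]
  {X : ℕ → Ω → ℕ} {C₀ : ℝ}

lemma BddOneDep.integral_mul_le (hX : BddOneDep P X C₀) (i j : ℕ) :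
    ∫ ω, (X i ω : ℝ) * X j ω ∂P ≤
      |covX P X i j| + factMoment P X 1 i * factMoment P X 1 j := by
  have hmem : ∀ i, MemLp (fun ω => (X i ω : ℝ)) 2 P := fun i =>
    MemLp.of_bound (StronglyMeasurable.of_discrete.comp_measurable
      (hX.meas i)).aestronglyMeasurable C₀
      (Filter.Eventually.of_forall fun ω => by simpa using hX.bdd i ω)
  have h := covariance_eq_sub (hmem i) (hmem j)
  rw [factMoment_one, factMoment_one]
  have h2 := le_abs_self (covX P X i j)
  rw [covX, h] at h2 ⊢
  simp only [Pi.mul_apply] at h2 ⊢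
  linarith

lemma Gamma1_eq_sum (hX : BddOneDep P X C₀) (n : ℕ) :
    Gamma1 P X n = ∑ k ∈ Finset.range n, factMoment P X 1 (k + 1) := by
  simp only [Gamma1, partialSum, Nat.cast_sum, factMoment_one]
  rw [integral_finsetSum _ fun i _ => hX.integrable_comp i fun x => (x : ℝ),
    sum_Icc_one_eq_sum_range]

section Constants

variable {h C : ℝ}

lemma constA_sq (hC : 0 ≤ C) : constA h C ^ 2 = Real.exp (h * C) ^ 2 * (2 + h) ^ 2 * C := by
  rw [constA, mul_pow, mul_pow, Real.sq_sqrt hC]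

lemma four_mul_le_constA_sq (hh : 0 ≤ h) (hC : 0 ≤ C) :
    4 * (Real.exp (h * C) ^ 2 * C) ≤ constA h C ^ 2 := by
  rw [constA_sq hC]
  have : 0 ≤ Real.exp (h * C) ^ 2 * C := by positivity
  nlinarith [mul_nonneg this hh, mul_nonneg (mul_nonneg this hh) hh]

lemma two_le_constA (hh : 0 ≤ h) (hC : 1 ≤ C) : 2 ≤ constA h C := by
  have h1 : 1 ≤ Real.exp (h * C) := Real.one_le_exp (by positivity)
  have h2 : 1 ≤ √C := Real.one_le_sqrt.2 hC
  rw [constA]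
  calc (2 : ℝ) = 1 * 2 * 1 := by norm_num
    _ ≤ _ := by gcongr; linarith

end Constants

/-- The generating function of the sum is the exponential of a jet which is close to the sum of the
first-order terms `E z ^ X k - 1`. -/
lemma BddOneDep.exists_exponent (hX : BddOneDep P X C₀) (hC₀ : 1 ≤ C₀) {h : ℝ} (hh : 0 ≤ h) (t : ℝ)
    (hsmall : ∀ k, constA h C₀ ^ 2 * factMoment P X 1 k ≤ 1 / 100) (n : ℕ) :
    ∃ a : Jet, (∫ ω, powProd X (jetPoint h t) n ω ∂P).fst = Complex.exp a.fst ∧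
      (∫ ω, powProd X (jetPoint h t) n ω ∂P).snd = a.snd * Complex.exp a.fst ∧
      ‖a‖ ≤ 4 * constA h C₀ ^ 2 * Gamma1 P X n ∧
      ‖a - ∑ k ∈ Finset.Icc 1 n, ∫ ω, (jetPoint h t ^ X k ω - 1) ∂P‖ ≤
        11 * constA h C₀ ^ 4 * ∑ k ∈ Finset.Icc 1 n, factMoment P X 1 k ^ 2 +
          1.25 * constA h C₀ ^ 3 * ∑ k ∈ Finset.range n, |covX P X k (k + 1)| := by
  set z := jetPoint h t with hz
  set a := constA h C₀ with ha
  -- `‖z ^ x - 1‖ ≤ c x`: the value contributes `2 e ^ (h C₀)`, the derivative `e ^ (h C₀)`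
  set c := 3 * Real.exp (h * C₀) with hc
  have ha2 : 2 ≤ a := two_le_constA hh hC₀
  have ha4 : 4 * (Real.exp (h * C₀) ^ 2 * C₀) ≤ a ^ 2 := four_mul_le_constA_sq hh (by linarith)
  have hexp1 : 1 ≤ Real.exp (h * C₀) := Real.one_le_exp (by positivity)
  have hc0 : 0 ≤ c := by positivity
  have hcC : c ^ 2 * C₀ ≤ 9 / 4 * a ^ 2 := by rw [hc]; linarith
  have hc2 : c ^ 2 ≤ 9 / 4 * a ^ 2 := le_trans (le_mul_of_one_le_right (by positivity) hC₀) hcC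
  have hcK : c ≤ 3 / 4 * a ^ 2 := by
    have h1 : Real.exp (h * C₀) ≤ Real.exp (h * C₀) ^ 2 * C₀ := by nlinarith
    rw [hc]; linarith
  have hν := factMoment_nonneg P X 1
  have H := hX.ratioData (z := z) (c := c) (K := a ^ 2) hc0
    (fun x hx => norm_jetPoint_pow_sub_one_le hh t hx) hcK hcC
    (fun k => by rw [← factMoment_one]; exact hsmall k)
  simp only [← factMoment_one] at H
  choose r hr1 hr2 hr3 using H.exists_ratio
  have hr33 : ∀ k, ‖r k - 1‖ ≤ 0.033 := fun k => (hr2 k).trans (by linarith [hsmall (k + 1)])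
  have hE := eq_exp_sum_jetLog (f := fun k => ∫ ω, powProd X z k ω ∂P) H.f_zero hr1
    (fun k => fst_ne_zero_of_norm_sub_one_lt (by linarith [hr33 k])) n
  refine ⟨_, hE.1, hE.2, ?_, ?_⟩
  · rw [Gamma1_eq_sum hX, Finset.mul_sum]
    refine norm_sum_le_of_le _ fun k _ => (norm_jetLog_le (hr33 k)).trans ?_
    have := hr2 k
    have := mul_nonneg (sq_nonneg a) (hν (k + 1))
    linarith
  · rw [sum_Icc_one_eq_sum_range, sum_Icc_one_eq_sum_range, ← Finset.sum_sub_distrib]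
    refine (norm_sum_le _ _).trans ?_
    refine sum_ratio_error_le (ν := factMoment P X 1) (c := fun k => |covX P X (k - 1) k|)
      (p := fun k => c ^ 2 * ∫ ω, (X (k - 1) ω : ℝ) * X k ω ∂P) ha2 ?_ (fun _ => abs_nonneg _) hν
      (fun k => ?_) (fun k => ?_) n
    · rw [factMoment_one]
      simp [hX.zero]
    · have h1 := hX.integral_mul_le k (k + 1)
      simp only [Nat.add_sub_cancel]
      have h2 : 0 ≤ |covX P X k (k + 1)| + factMoment P X 1 k * factMoment P X 1 (k + 1) :=
        add_nonneg (abs_nonneg _) (mul_nonneg (hν _) (hν _))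
      gcongr
    · have h1 := norm_jetLog_sub_le (hr33 k)
      have h2 := hr3 k
      have h3 : ‖r k - 1‖ ^ 2 ≤ (3.3 * (a ^ 2 * factMoment P X 1 (k + 1))) ^ 2 := by
        have := hr2 k
        gcongr
      simp only [centeredProd_self] at h2
      calc ‖jetLog (r k) - ∫ ω, (z ^ X (k + 1) ω - 1) ∂P‖
          = ‖(jetLog (r k) - (r k - 1)) + (r k - 1 - ∫ ω, (z ^ X (k + 1) ω - 1) ∂P)‖ := by
            rw [sub_add_sub_cancel]
        _ ≤ _ := norm_add_le_of_le (h1.trans (by gcongr)) h2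

lemma sqrt_mul_le : √(1 + Real.pi ^ 2 / 6) * 1.25 ≤ √(Real.pi + 1) := by
  refine Real.le_sqrt_of_sq_le ?_
  rw [mul_pow, Real.sq_sqrt (by positivity)]
  nlinarith [Real.pi_gt_d4, Real.pi_lt_d4]

/-- The final bookkeeping: `x` and `y` stand for the contributions of the squared means and of the
covariances. -/
lemma combine_bounds {e p q E G x y s : ℝ} (he : 0 ≤ e) (hq : 0 ≤ q) (hqp : q * 1.25 ≤ p)
    (hE : 0 ≤ E) (hs : 0 ≤ s) (hG : 0 ≤ G) (hx : 0 ≤ x) (hy : 0 ≤ y) :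
    q * (e * (E + (11 * x + 1.25 * y)) +
      e * (G * (E + (11 * x + 1.25 * y)) + (s * E + (11 * x + 1.25 * y)))) ≤
      e * (p * ((s + 1 + G) * E)) + e * (p * ((80 + 24 * G) * x + (4.4 + G) * y)) := by
  have hT : (2 + G) * (11 * x + 1.25 * y) ≤ 1.25 * ((80 + 24 * G) * x + (4.4 + G) * y) := by
    nlinarith [mul_nonneg hG hx, mul_nonneg hG hy]
  have g0 : 0 ≤ (s + 1 + G) * E := by positivity
  have g1 : 0 ≤ (80 + 24 * G) * x + (4.4 + G) * y := by positivity
  have hqp' : q ≤ p := by linarith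
  calc _ = e * (q * ((s + 1 + G) * E) + q * ((2 + G) * (11 * x + 1.25 * y))) := by ring
    _ ≤ e * (p * ((s + 1 + G) * E) + q * (1.25 * ((80 + 24 * G) * x + (4.4 + G) * y))) := by
      gcongr
    _ = e * (p * ((s + 1 + G) * E) + (q * 1.25) * ((80 + 24 * G) * x + (4.4 + G) * y)) := by ring
    _ ≤ e * (p * ((s + 1 + G) * E) + p * ((80 + 24 * G) * x + (4.4 + G) * y)) := by gcongr
    _ = _ := by ring

/-- The comparison for variables which are bounded everywhere. -/
theorem BddOneDep.tsum_le (hX : BddOneDep P X C₀) (hC₀ : 1 ≤ C₀) {h : ℝ} (hh : 0 ≤ h)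
    {s : ℕ} (hs : 1 ≤ s) (lam : ℕ → ℝ≥0)
    (hsmall : ∀ k, constA h C₀ ^ 2 * factMoment P X 1 k ≤ 1 / 100) (n : ℕ) :
    Summable (fun k : ℕ => Real.exp (h * k) *
      |(P.map (partialSum X n)).real {k} - (compoundPoisson s lam).real {k}|) ∧
    ∑' k : ℕ, Real.exp (h * k) *
      |(P.map (partialSum X n)).real {k} - (compoundPoisson s lam).real {k}| ≤
      constK1 h C₀ (Gamma1 P X n) s lam * momentGap P X n s lam +
        constK2 h C₀ (Gamma1 P X n) s lam * ∑ j ∈ Finset.Icc 1 n, factMoment P X (s + 1) j +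
        constK3 h C₀ (Gamma1 P X n) s lam * ∑ j ∈ Finset.Icc 1 n, factMoment P X 1 j ^ 2 +
        constK4 h C₀ (Gamma1 P X n) s lam * ∑ k ∈ Finset.range n, |covX P X k (k + 1)| := by
  set S := partialSum X n with hS
  have hSm : Measurable S := by
    rw [hS]
    unfold partialSum
    exact Finset.measurable_fun_sum _ fun i _ => hX.meas i
  have hSle : ∀ ω, (S ω : ℝ) ≤ n * C₀ := by
    intro ω
    rw [hS, partialSum, Nat.cast_sum]
    exact (Finset.sum_le_card_nsmul _ _ _ fun i _ => hX.bdd i ω).trans (by simp)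
  have hmapint : ∀ g : ℕ → ℂ, Integrable g (P.map S) := by
    intro g
    rw [integrable_map_measure .of_discrete hSm.aemeasurable]
    refine Integrable.of_bound (C := ∑ x ∈ Finset.range (⌊n * C₀⌋₊ + 1), ‖g x‖)
      (StronglyMeasurable.of_discrete.comp_measurable hSm).aestronglyMeasurable
      (Filter.Eventually.of_forall fun ω => ?_)
    exact Finset.single_le_sum (f := fun x => ‖g x‖) (fun _ _ => norm_nonneg _)
      (Finset.mem_range_succ_iff.2 (Nat.le_floor (hSle ω)))
  set Γ := Gamma1 P X n with hΓ
  set a := constA h C₀ with ha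
  set V := ∑ j ∈ Finset.Icc 1 n, factMoment P X 1 j ^ 2 with hV
  set W := ∑ k ∈ Finset.range n, |covX P X k (k + 1)| with hW
  set D := momentGap P X n s lam with hD
  set N := ∑ j ∈ Finset.Icc 1 n, factMoment P X (s + 1) j with hN
  set M := max (4 * a ^ 2 * Γ) (∑ m ∈ Finset.Icc 1 s, (lam m : ℝ) * (Real.exp (h * m) + 1)) with hM
  set E := (Real.exp h + 1) ^ s * D +
    Real.exp (h * C₀) * (Real.exp h + 1) ^ (s + 1) / ((s + 1).factorial : ℝ) * N with hE
  set T := 11 * (a ^ 4 * V) + 1.25 * (a ^ 3 * W) with hT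
  have hΓ0 : 0 ≤ Γ := integral_nonneg fun _ => Nat.cast_nonneg _
  have ha2 : 2 ≤ a := two_le_constA hh hC₀
  have hV0 : 0 ≤ V := Finset.sum_nonneg fun _ _ => sq_nonneg _
  have hW0 : 0 ≤ W := Finset.sum_nonneg fun _ _ => abs_nonneg _
  have hD0 : 0 ≤ D := Finset.sum_nonneg fun _ _ => abs_nonneg _
  have hN0 : 0 ≤ N := Finset.sum_nonneg fun _ _ => factMoment_nonneg _ _ _ _
  have hE0 : 0 ≤ E := by positivity
  have hT0 : 0 ≤ T := by positivity
  set G := 4 * a ^ 2 * Γ with hG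
  have hG0 : 0 ≤ G := by positivity
  have key : ∀ t : ℝ,
      ‖∫ k : ℕ, Complex.exp (h + Complex.I * t) ^ k ∂P.map S -
        ∫ k : ℕ, Complex.exp (h + Complex.I * t) ^ k ∂compoundPoisson s lam‖ ≤
          Real.exp M * (E + T) ∧
      ‖∫ k : ℕ, k * Complex.I * Complex.exp (h + Complex.I * t) ^ k ∂P.map S -
        ∫ k : ℕ, k * Complex.I * Complex.exp (h + Complex.I * t) ^ k ∂compoundPoisson s lam‖ ≤
          Real.exp M * (G * (E + T) + (s * E + T)) := by
    intro t
    obtain ⟨A, hA1, hA2, hA3, hA4⟩ := hX.exists_exponent hC₀ hh t hsmall n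
    obtain ⟨hB1, hB2⟩ := hX.norm_sum_sub_cpExponent_le hh t hs lam n hE
    set B := cpExponent s lam (jetPoint h t) with hB
    set L := ∑ k ∈ Finset.Icc 1 n, ∫ ω, (jetPoint h t ^ X k ω - 1) ∂P with hL
    have hint : Integrable (powProd X (jetPoint h t) n) P :=
      hX.integrable_prod (Finset.range (n + 1)) fun x => jetPoint h t ^ x
    rw [fst_integral_jet hint] at hA1
    rw [snd_integral_jet hint] at hA2
    simp only [powProd_eq_pow_partialSum hX.zero, fst_jetPoint_pow, snd_jetPoint_pow] at hA1 hA2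
    rw [integral_map hSm.aemeasurable .of_discrete, integral_map hSm.aemeasurable .of_discrete,
      hA1, hA2, integral_pow_compoundPoisson, integral_natCast_mul_pow_compoundPoisson,
      ← fst_cpExponent, ← snd_cpExponent, ← hB]
    have hAf : ‖A.fst‖ ≤ G := le_trans (by
      rw [TrivSqZeroExt.norm_def]; linarith [norm_nonneg A.snd]) hA3
    have hAs : ‖A.snd‖ ≤ G := le_trans (by
      rw [TrivSqZeroExt.norm_def]; linarith [norm_nonneg A.fst]) hA3
    have hAM : A.fst.re ≤ M := (Complex.re_le_norm _).trans (hAf.trans (le_max_left _ _))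
    have hBM : B.fst.re ≤ M := (re_fst_cpExponent_le s lam h t).trans (le_max_right _ _)
    rw [TrivSqZeroExt.norm_def, mul_assoc, mul_assoc] at hA4
    have hsplit : A - B = (A - L) + (L - B) := by abel
    have h1 : ‖(A - B).fst‖ ≤ E + T := by
      rw [hsplit, fst_add, add_comm E]
      exact norm_add_le_of_le (by linarith [norm_nonneg (A - L).snd]) hB1
    have h2 : ‖(A - B).snd‖ ≤ s * E + T := by
      rw [hsplit, snd_add, add_comm _ T]
      exact norm_add_le_of_le (by linarith [norm_nonneg (A - L).fst]) hB2
    obtain ⟨h3, h4⟩ := norm_exp_jet_sub_le hAM hBM hAs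
    refine ⟨h3.trans ?_, h4.trans ?_⟩
    · gcongr
    · gcongr
  have hfin := summable_and_tsum_exp_mul_abs_sub_le (hmapint _)
    (integrable_pow_compoundPoisson s lam _) (hmapint _)
    (integrable_natCast_mul_pow_compoundPoisson s lam _) (fun t => (key t).1) (fun t => (key t).2)
  refine ⟨hfin.1, hfin.2.trans ?_⟩
  have hsq := sqrt_mul_le
  set q := √(1 + Real.pi ^ 2 / 6) with hq
  set p := √(Real.pi + 1) with hp
  have hq0 : 0 ≤ q := Real.sqrt_nonneg _
  have hs0 : (0 : ℝ) ≤ s := Nat.cast_nonneg s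
  have hKE : constK1 h C₀ Γ s lam * D + constK2 h C₀ Γ s lam * N =
      Real.exp M * (p * ((s + 1 + G) * E)) := by
    rw [constK1, constK2, constPsi, ← ha, ← hM, hE, hG]
    ring
  have hKT : constK3 h C₀ Γ s lam * V + constK4 h C₀ Γ s lam * W =
      Real.exp M * (p * ((80 + 24 * G) * (a ^ 4 * V) + (4.4 + G) * (a ^ 3 * W))) := by
    rw [constK3, constK4, constPsi, ← ha, ← hM, hG]
    ring
  calc _ ≤ _ := combine_bounds (x := a ^ 4 * V) (y := a ^ 3 * W) (Real.exp_pos M).le hq0 hsq hE0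
        hs0 hG0 (by positivity) (by positivity)
    _ = _ := by rw [← hKE, ← hKT]; ring

end Comparison

/-! ### Reduction to variables which are bounded everywhere -/

section Truncation

variable {Ω : Type*} {X : ℕ → Ω → ℕ} {C₀ : ℝ} {n : ℕ}

/-- The variables `X 1, …, X n` truncated at `C₀` and extended by `0` to all indices. -/
noncomputable def truncated (X : ℕ → Ω → ℕ) (n : ℕ) (C₀ : ℝ) (i : ℕ) (ω : Ω) : ℕ :=
  if i ∈ Finset.Icc 1 n then min (X i ω) ⌊C₀⌋₊ else 0

lemma truncated_of_notMem {i : ℕ} (hi : i ∉ Finset.Icc 1 n) (ω : Ω) :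
    truncated X n C₀ i ω = 0 := if_neg hi

lemma comap_truncated_le (i : ℕ) :
    MeasurableSpace.comap (truncated X n C₀ i) ⊤ ≤ MeasurableSpace.comap (X i) ⊤ := by
  have h : truncated X n C₀ i =
      (fun x => if i ∈ Finset.Icc 1 n then min x ⌊C₀⌋₊ else 0) ∘ X i := rfl
  rw [h, ← MeasurableSpace.comap_comp]
  exact MeasurableSpace.comap_mono le_top

lemma comap_truncated_of_notMem {i : ℕ} (hi : i ∉ Finset.Icc 1 n) :
    MeasurableSpace.comap (truncated X n C₀ i) ⊤ = ⊥ := by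
  have h : truncated X n C₀ i = fun _ => 0 := funext (truncated_of_notMem hi)
  rw [h, MeasurableSpace.comap_const]

lemma past_truncated_le (r : ℕ) :
    past (truncated X n C₀) r ≤ ⨆ i ∈ Finset.Icc 1 r, MeasurableSpace.comap (X i) ⊤ := by
  refine iSup₂_le fun i hi => ?_
  by_cases h : i ∈ Finset.Icc 1 n
  · exact (comap_truncated_le i).trans (le_iSup₂_of_le i
      (Finset.mem_Icc.2 ⟨(Finset.mem_Icc.1 h).1, hi⟩) le_rfl)
  · rw [comap_truncated_of_notMem h]
    exact bot_le

lemma future_truncated_le (t : ℕ) :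
    future (truncated X n C₀) t ≤ ⨆ i ∈ Finset.Icc t n, MeasurableSpace.comap (X i) ⊤ := by
  refine iSup₂_le fun i hi => ?_
  by_cases h : i ∈ Finset.Icc 1 n
  · exact (comap_truncated_le i).trans (le_iSup₂_of_le i
      (Finset.mem_Icc.2 ⟨hi, (Finset.mem_Icc.1 h).2⟩) le_rfl)
  · rw [comap_truncated_of_notMem h]
    exact bot_le

variable [MeasurableSpace Ω] {P : Measure Ω}

lemma bddOneDep_truncated [IsProbabilityMeasure P] (hX : ∀ i ∈ Finset.Icc 1 n, Measurable (X i))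
    (hdep : IsMDependent 1 n X P) (hC₀ : 0 ≤ C₀) : BddOneDep P (truncated X n C₀) C₀ where
  meas i := by
    by_cases h : i ∈ Finset.Icc 1 n
    · rw [measurable_iff_comap_le]
      exact (comap_truncated_le i).trans (hX i h).comap_le
    · rw [measurable_iff_comap_le]
      exact (comap_truncated_of_notMem h).le.trans bot_le
  zero ω := truncated_of_notMem (by simp) ω
  bdd i ω := by
    rw [truncated]
    split_ifs
    · exact (Nat.cast_le.2 (min_le_right _ _)).trans (Nat.floor_le hC₀)
    · simpa using hC₀
  indep r t hrt := by
    refine indep_of_indep_of_le_left (indep_of_indep_of_le_right ?_ (future_truncated_le t))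
      (past_truncated_le r)
    rcases Nat.eq_zero_or_pos r with rfl | hr
    · simpa using indep_bot_left _
    rcases lt_or_ge n t with ht | ht
    · simpa [Finset.Icc_eq_empty_of_lt ht] using indep_bot_right _
    · exact hdep r t hr hrt ht

lemma ae_eq_truncated (hbdd : ∀ i ∈ Finset.Icc 1 n, ∀ᵐ ω ∂P, (X i ω : ℝ) ≤ C₀) :
    ∀ᵐ ω ∂P, ∀ i ∈ Finset.Icc 1 n, X i ω = truncated X n C₀ i ω := by
  rw [Filter.eventually_all_finset]
  intro i hi
  filter_upwards [hbdd i hi] with ω hω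
  rw [truncated, if_pos hi, min_eq_left (Nat.le_floor hω)]

section Congr

variable {Y : ℕ → Ω → ℕ}

lemma factMoment_congr_ae (h : ∀ᵐ ω ∂P, ∀ i ∈ Finset.Icc 1 n, X i ω = Y i ω)
    (m : ℕ) {j : ℕ} (hj : j ∈ Finset.Icc 1 n) :
    factMoment P X m j = factMoment P Y m j :=
  integral_congr_ae (by filter_upwards [h] with ω hω; rw [hω j hj])

lemma partialSum_congr_ae (h : ∀ᵐ ω ∂P, ∀ i ∈ Finset.Icc 1 n, X i ω = Y i ω) :
    partialSum X n =ᵐ[P] partialSum Y n := by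
  filter_upwards [h] with ω hω
  exact Finset.sum_congr rfl hω

lemma Gamma1_congr_ae (h : ∀ᵐ ω ∂P, ∀ i ∈ Finset.Icc 1 n, X i ω = Y i ω) :
    Gamma1 P X n = Gamma1 P Y n :=
  integral_congr_ae (by filter_upwards [partialSum_congr_ae h] with ω hω; rw [hω])

lemma covX_congr_ae (h : ∀ᵐ ω ∂P, ∀ i ∈ Finset.Icc 1 n, X i ω = Y i ω)
    {i j : ℕ} (hi : i ∈ Finset.Icc 1 n) (hj : j ∈ Finset.Icc 1 n) :
    covX P X i j = covX P Y i j := by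
  have e : ∀ i ∈ Finset.Icc 1 n, (fun ω => (X i ω : ℝ)) =ᵐ[P] fun ω => (Y i ω : ℝ) := by
    intro i hi
    filter_upwards [h] with ω hω
    rw [hω i hi]
  rw [covX, covX, covariance, covariance, integral_congr_ae (e i hi), integral_congr_ae (e j hj)]
  refine integral_congr_ae ?_
  filter_upwards [e i hi, e j hj] with ω h1 h2
  rw [h1, h2]

end Congr

/-- The term `k = 0` vanishes because `X 0 = 0`. -/
lemma sum_abs_covX_eq [IsProbabilityMeasure P] (h0 : ∀ ω, X 0 ω = 0) (n : ℕ) :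
    ∑ k ∈ Finset.range n, |covX P X k (k + 1)| = ∑ j ∈ Finset.Icc 2 n, |covX P X (j - 1) j| := by
  rcases n with _ | n
  · simp
  rw [Finset.sum_range_succ']
  have h1 : covX P X 0 (0 + 1) = 0 := by
    simp only [covX, h0]
    exact covariance_const_left _
  rw [h1, abs_zero, add_zero, Finset.range_eq_Ico,
    Finset.sum_Ico_add' (fun j => |covX P X j (j + 1)|) 0 n 1,
    ← Finset.Ico_add_one_right_eq_Icc,
    ← Finset.sum_Ico_add' (fun j => |covX P X (j - 1) j|) 1 (n + 1) 1]
  rfl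

end Truncation

end CPConv

theorem mainTheorem1 {Ω : Type*} [MeasurableSpace Ω] (P : Measure Ω) [IsProbabilityMeasure P]
    (n : ℕ) (X : ℕ → Ω → ℕ) (hX : ∀ i ∈ Finset.Icc 1 n, Measurable (X i))
    (hdep : CPConv.IsMDependent 1 n X P)
    (C₀ : ℝ) (hC₀ : 1 ≤ C₀) (hbdd : ∀ i ∈ Finset.Icc 1 n, ∀ᵐ ω ∂P, (X i ω : ℝ) ≤ C₀)
    (s : ℕ) (hs : 1 ≤ s) (h : ℝ) (hh : 0 ≤ h) (lam : ℕ → ℝ≥0)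
    (hsmall : CPConv.constA h C₀ ^ 2 * CPConv.maxNuOne P X n ≤ 1 / 100) :
    Summable (fun k : ℕ => Real.exp (h * k) *
      |(P.map (CPConv.partialSum X n)).real {k} - (CPConv.compoundPoisson s lam).real {k}|) ∧
    ∑' k : ℕ, Real.exp (h * k) *
      |(P.map (CPConv.partialSum X n)).real {k} - (CPConv.compoundPoisson s lam).real {k}| ≤
      CPConv.constK1 h C₀ (CPConv.Gamma1 P X n) s lam *
          ∑ m ∈ Finset.Icc 1 s,
            |1 / (m.factorial : ℝ) * ∑ j ∈ Finset.Icc 1 n, CPConv.factMoment P X m j -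
              ∑ l ∈ Finset.Icc m s, (l.choose m : ℝ) * (lam l : ℝ)| +
        CPConv.constK2 h C₀ (CPConv.Gamma1 P X n) s lam *
          ∑ j ∈ Finset.Icc 1 n, CPConv.factMoment P X (s + 1) j +
        CPConv.constK3 h C₀ (CPConv.Gamma1 P X n) s lam *
          ∑ j ∈ Finset.Icc 1 n, CPConv.factMoment P X 1 j ^ 2 +
        CPConv.constK4 h C₀ (CPConv.Gamma1 P X n) s lam *
          ∑ j ∈ Finset.Icc 2 n, |CPConv.covX P X (j - 1) j| := by
  have hY := CPConv.bddOneDep_truncated hX hdep (zero_le_one.trans hC₀)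
  have hXY := CPConv.ae_eq_truncated hbdd
  set Y := CPConv.truncated X n C₀ with hYdef
  have hmom : ∀ m, ∀ j ∈ Finset.Icc 1 n, CPConv.factMoment P X m j = CPConv.factMoment P Y m j :=
    fun m j hj => CPConv.factMoment_congr_ae hXY m hj
  have hsmallY : ∀ k, CPConv.constA h C₀ ^ 2 * CPConv.factMoment P Y 1 k ≤ 1 / 100 := by
    intro k
    by_cases hk : k ∈ Finset.Icc 1 n
    · rw [← hmom 1 k hk]
      refine le_trans ?_ hsmall
      gcongr
      exact le_ciSup (f := fun j : Finset.Icc 1 n => CPConv.factMoment P X 1 j)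
        (Set.finite_range _).bddAbove ⟨k, hk⟩
    · simp [CPConv.factMoment_one, hYdef, CPConv.truncated_of_notMem hk]
  have main := hY.tsum_le hC₀ hh hs lam hsmallY n
  rw [CPConv.sum_abs_covX_eq hY.zero, CPConv.momentGap, ← CPConv.Gamma1_congr_ae hXY,
    ← Measure.map_congr (CPConv.partialSum_congr_ae hXY)] at main
  have hcov : ∀ j ∈ Finset.Icc 2 n, |CPConv.covX P X (j - 1) j| = |CPConv.covX P Y (j - 1) j| := by
    intro j hj
    rw [Finset.mem_Icc] at hj
    rw [CPConv.covX_congr_ae hXY] <;> rw [Finset.mem_Icc] <;> omega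
  simp only [Finset.sum_congr rfl hcov, Finset.sum_congr rfl (hmom _)]
  have hsq : ∑ j ∈ Finset.Icc 1 n, CPConv.factMoment P X 1 j ^ 2 =
      ∑ j ∈ Finset.Icc 1 n, CPConv.factMoment P Y 1 j ^ 2 :=
    Finset.sum_congr rfl fun j hj => by rw [hmom 1 j hj]
  rw [hsq]
  exact main
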